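/- Let $X$ be a $d$-dimensional smooth manifold, $n\ge 0$ an integer, $C_{ij}^k\in C^\infty(X)$ ($1\le i,j,k\le n$) smooth functions and $F_1,\dots,F_n$ smooth vector fields on $X$. A \emph{realization} of these data is a triple $(M,\theta,h)$ consisting of an $n$-dimensional smooth manifold $M$, a coframe $\theta=(\theta^1,\dots,\theta^n)$ on $M$ and a smooth map $h:M\to X$ such that $$d\theta^k=\sum_{i<j}(C_{ij}^k\circ h)\,\theta^i\wedge\theta^j,\qquad dh=\sum_i (F_i\circ h)\,\theta^i .$$ Assume that the data determine a Lie algebroid $A=X\times\mathbb R^n\to X$ (the \emph{classifying Lie algebroid}), with bracket and anchor given on the standard frame by $[e_i,e_j]=-\sum_k C_{ij}^k e_k$ and $\sharp e_i=F_i$. The orbits of $A$ are the equivalence classes of points of $X$ that can be joined by (piecewise smooth) $A$-paths; they are immersed submanifolds tangent to the image of $\sharp$. Assume that $A$ is \emph{weakly integrable}: for every orbit $L$, the restriction $A|_L$ is isomorphic to the Lie algebroid of a Lie groupoid over $L$. Let $(M_0,\theta_0,h_0)$ and $(M_1,\theta_1,h_1)$ be realizations and let $m_0\in M_0$, $m_1\in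 M_1$. Then the following are equivalent: \begin{enumerate} \item there are a connected realization $(M,\theta,h)$ and points $p_0,p_1\in M$ such that, for $a=0,1$, the germ of $(M_a,\theta_a,h_a)$ at $m_a$ is the germ of $(M,\theta,h)$ at $p_a$, i.e. there is a diffeomorphism $\phi_a$ from a neighbourhood of $m_a$ in $M_a$ onto a neighbourhood of $p_a$ in $M$ with $\phi_a(m_a)=p_a$, $\phi_a^*\theta=\theta_a$ and $h\circ\phi_a=h_a$; \item the points $h_0(m_0)$ and $h_1(m_1)$ lie in the same orbit of $A$. \end{enumerate} -/

import Mathlib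

open scoped Manifold ContDiff

universe u v w

noncomputable section

namespace Cartan

/-- A vector field `V` on a manifold modelled on `ℝᵈ` is smooth. -/
def SmoothField {d : ℕ} {X : Type u} [TopologicalSpace X]
    [ChartedSpace (EuclideanSpace ℝ (Fin d)) X] [IsManifold (𝓡 d) ∞ X]
    (V : ∀ x : X, TangentSpace (𝓡 d) x) : Prop :=
  ContMDiff (𝓡 d) (𝓡 d).tangent ∞ (fun x => (⟨x, V x⟩ : TangentBundle (𝓡 d) X))

/-- Initial data `(n, X, C_{ij}^k, F_i)` of a Cartan realization problem on the `d`-dimensional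
manifold `X`: smooth functions `C i j k` (the function `C_{ij}^k`) and smooth vector fields
`F i`. -/
structure Data (n d : ℕ) (X : Type u) [TopologicalSpace X]
    [ChartedSpace (EuclideanSpace ℝ (Fin d)) X] [IsManifold (𝓡 d) ∞ X] where
  C : Fin n → Fin n → Fin n → X → ℝ
  F : Fin n → ∀ x : X, TangentSpace (𝓡 d) x
  smooth_C : ∀ i j k, ContMDiff (𝓡 d) 𝓘(ℝ, ℝ) ∞ (C i j k)
  smooth_F : ∀ i, SmoothField (F i)

namespace Data

variable {n d : ℕ} {X : Type u} [TopologicalSpace X]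
  [ChartedSpace (EuclideanSpace ℝ (Fin d)) X] [IsManifold (𝓡 d) ∞ X] (D : Data n d X)

/-- The anchor `♯ : X × ℝⁿ → TX`, `♯(e_i) = F_i`. -/
def anchor (x : X) (a : Fin n → ℝ) : TangentSpace (𝓡 d) x := ∑ i, a i • D.F i x

/-- The bracket of two sections `α = ∑ α^i e_i`, `β = ∑ β^j e_j` of the trivial bundle
`A = X × ℝⁿ`: the `ℝ`-bilinear extension by the Leibniz rule of `[e_i, e_j] = -∑_k C_{ij}^k e_k`,
that is
`[α, β]^k = ♯α(β^k) - ♯β(α^k) - ∑_{i,j} C_{ij}^k α^i β^j`. -/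
def bracket (α β : X → Fin n → ℝ) : X → Fin n → ℝ := fun x k =>
  mvfderiv (𝓡 d) (fun y => β y k) x (D.anchor x (α x))
    - mvfderiv (𝓡 d) (fun y => α y k) x (D.anchor x (β x))
    - ∑ i, ∑ j, D.C i j k x * α x i * β x j

/-- Smooth sections of the trivial bundle `X × ℝⁿ`. -/
def SmoothSection (α : X → Fin n → ℝ) : Prop :=
  ContMDiff (𝓡 d) 𝓘(ℝ, Fin n → ℝ) ∞ α

/-- The data `-C_{ij}^k`, `F_i` determine a Lie algebroid structure on `A = X × ℝⁿ` (the
classifying Lie algebroid): the bracket above is a Lie bracket on the space of smooth sections of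
`A`, and it satisfies the Leibniz identity with respect to the anchor. -/
structure IsLieAlgebroid : Prop where
  skew : ∀ α β : X → Fin n → ℝ, SmoothSection (d := d) α → SmoothSection (d := d) β →
    D.bracket α β = -D.bracket β α
  jacobi : ∀ α β γ : X → Fin n → ℝ, SmoothSection (d := d) α → SmoothSection (d := d) β →
    SmoothSection (d := d) γ →
    D.bracket α (D.bracket β γ) + D.bracket β (D.bracket γ α) + D.bracket γ (D.bracket α β) = 0
  leibniz : ∀ (α β : X → Fin n → ℝ) (f : X → ℝ), SmoothSection (d := d) α →
    SmoothSection (d := d) β → ContMDiff (𝓡 d) 𝓘(ℝ, ℝ) ∞ f →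
    D.bracket α (fun x => f x • β x) =
      fun x => f x • D.bracket α β x + mvfderiv (𝓡 d) f x (D.anchor x (α x)) • β x

/-- `x` and `y` are joined by a smooth `A`-path: a smooth path `t ↦ (γ t, a t)`, `t ∈ [0,1]`, in
`A = X × ℝⁿ` with `γ' = ♯ a`, from `γ 0 = x` to `γ 1 = y`. -/
def APathJoined (x y : X) : Prop :=
  ∃ (γ : ℝ → X) (a : ℝ → Fin n → ℝ),
    ContMDiffOn 𝓘(ℝ, ℝ) (𝓡 d) ∞ γ (Set.Icc 0 1) ∧ ContDiffOn ℝ ∞ a (Set.Icc 0 1) ∧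
    γ 0 = x ∧ γ 1 = y ∧
    ∀ t ∈ Set.Icc (0 : ℝ) 1, HasMFDerivWithinAt 𝓘(ℝ, ℝ) (𝓡 d) γ (Set.Icc 0 1) t
      ((1 : ℝ →L[ℝ] ℝ).smulRight (D.anchor (γ t) (a t)))

/-- `x` and `y` lie in the same orbit of `A`: they are joined by finitely many `A`-paths. -/
def SameOrbit : X → X → Prop := Relation.EqvGen D.APathJoined

/-- The orbit of `A` through `x`. -/
def orbit (x : X) : Set X := {y | D.SameOrbit x y}

/-- `ι : L → X` presents the orbit through `x₀` as an immersed submanifold of `X`: it is a smooth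
injective immersion onto the orbit, whose tangent spaces are the images of the anchor. -/
structure IsLeaf {l : ℕ} {L : Type u} [TopologicalSpace L]
    [ChartedSpace (EuclideanSpace ℝ (Fin l)) L] [IsManifold (𝓡 l) ∞ L]
    (x₀ : X) (ι : L → X) : Prop where
  immersion : Manifold.IsImmersion (𝓡 l) (𝓡 d) ∞ ι
  injective : Function.Injective ι
  range_eq : Set.range ι = D.orbit x₀
  tangent : ∀ p : L, Set.range (mfderiv (𝓡 l) (𝓡 d) ι p) = Set.range (D.anchor (ι p))

/-- `D'` is the restriction `A|_L` of `D` along `ι : L → X`: its structure functions are the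
`C_{ij}^k ∘ ι` and its vector fields are `ι`-related to the `F_i`. -/
structure IsRestriction {l : ℕ} {L : Type u} [TopologicalSpace L]
    [ChartedSpace (EuclideanSpace ℝ (Fin l)) L] [IsManifold (𝓡 l) ∞ L]
    (ι : L → X) (D' : Data n l L) : Prop where
  C_eq : ∀ i j k p, D'.C i j k p = D.C i j k (ι p)
  F_related : ∀ i p, mfderiv (𝓡 l) (𝓡 d) ι p (D'.F i p) = D.F i (ι p)

end Data

/-- A Lie groupoid with arrows `G` over `L`, with source `s` and target `t`. The product
`mul g h = gh` is meaningful when `s g = t h`. As usual `G` need not be Hausdorff, but the source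
fibres are. -/
structure LieGroupoid (m l : ℕ) (G L : Type u)
    [TopologicalSpace G] [ChartedSpace (EuclideanSpace ℝ (Fin m)) G] [IsManifold (𝓡 m) ∞ G]
    [TopologicalSpace L] [ChartedSpace (EuclideanSpace ℝ (Fin l)) L] [IsManifold (𝓡 l) ∞ L] where
  s : G → L
  t : G → L
  one : L → G
  inv : G → G
  mul : G → G → G
  s_one : ∀ x, s (one x) = x
  t_one : ∀ x, t (one x) = x
  s_inv : ∀ g, s (inv g) = t g
  t_inv : ∀ g, t (inv g) = s g
  s_mul : ∀ g h, s g = t h → s (mul g h) = s h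
  t_mul : ∀ g h, s g = t h → t (mul g h) = t g
  mul_assoc : ∀ g h k, s g = t h → s h = t k → mul (mul g h) k = mul g (mul h k)
  one_mul : ∀ g, mul (one (t g)) g = g
  mul_one : ∀ g, mul g (one (s g)) = g
  inv_mul : ∀ g, mul (inv g) g = one (s g)
  mul_inv : ∀ g, mul g (inv g) = one (t g)
  submersion_s : Manifold.IsSubmersion (𝓡 m) (𝓡 l) ∞ s
  submersion_t : Manifold.IsSubmersion (𝓡 m) (𝓡 l) ∞ t
  smooth_one : ContMDiff (𝓡 l) (𝓡 m) ∞ one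
  smooth_inv : ContMDiff (𝓡 m) (𝓡 m) ∞ inv
  smooth_mul : ContMDiffOn ((𝓡 m).prod (𝓡 m)) (𝓡 m) ∞ (fun p : G × G => mul p.1 p.2)
    {p | s p.1 = t p.2}
  t2_fibre : ∀ x, T2Space {g : G // s g = x}

namespace LieGroupoid

variable {m l : ℕ} {G L : Type u}
    [TopologicalSpace G] [ChartedSpace (EuclideanSpace ℝ (Fin m)) G] [IsManifold (𝓡 m) ∞ G]
    [TopologicalSpace L] [ChartedSpace (EuclideanSpace ℝ (Fin l)) L] [IsManifold (𝓡 l) ∞ L]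
    (𝒢 : LieGroupoid m l G L)

/-- A vector field on `G` is right invariant: it is tangent to the source fibres and it is
preserved by the differentials of the right translations
`R_g : s⁻¹(t g) → s⁻¹(s g)`, `R_g h = hg`. -/
structure IsRightInvariant (V : ∀ g : G, TangentSpace (𝓡 m) g) : Prop where
  tangent : ∀ g, mfderiv (𝓡 m) (𝓡 l) 𝒢.s g (V g) = 0
  invariant : ∀ h g, 𝒢.s h = 𝒢.t g →
    V (𝒢.mul h g) =
      mfderivWithin (𝓡 m) (𝓡 m) (fun k => 𝒢.mul k g) {k | 𝒢.s k = 𝒢.t g} h (V h)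

/-- `𝒢` integrates the Lie algebroid `A = L × ℝⁿ` given by `D`: the Lie algebroid of `𝒢`, whose
fibre at `x` is `ker d_{1_x} s` and whose sections are the smooth right invariant vector fields
on `G`, is isomorphic to `A`. The isomorphism is given by the right invariant vector fields `R i`
corresponding to the sections `e_i`, so that a section `α` of `A` corresponds to
`∑ i, (α^i ∘ t) R i`; it is fibrewise bijective and preserves anchors and brackets. -/
def Integrates {n : ℕ} (D : Data n l L) : Prop :=
  ∃ R : Fin n → ∀ g : G, TangentSpace (𝓡 m) g,
    (∀ i, SmoothField (R i) ∧ 𝒢.IsRightInvariant (R i)) ∧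
    (∀ x, ∀ v : TangentSpace (𝓡 m) (𝒢.one x),
      mfderiv (𝓡 m) (𝓡 l) 𝒢.s (𝒢.one x) v = 0 →
        ∃! a : Fin n → ℝ, ∑ i, a i • R i (𝒢.one x) = v) ∧
    (∀ i g, mfderiv (𝓡 m) (𝓡 l) 𝒢.t g (R i g) = D.F i (𝒢.t g)) ∧
    (∀ α β : L → Fin n → ℝ, Data.SmoothSection (d := l) α → Data.SmoothSection (d := l) β →
      ∀ g, VectorField.mlieBracket (𝓡 m)
          (fun h => ∑ i, α (𝒢.t h) i • R i h) (fun h => ∑ i, β (𝒢.t h) i • R i h) g =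
        ∑ i, D.bracket α β (𝒢.t g) i • R i g)

end LieGroupoid

namespace Data

/-- The Lie algebroid given by `D` is integrable: it is the Lie algebroid of a Lie groupoid. -/
def IsIntegrable {n l : ℕ} {L : Type u} [TopologicalSpace L]
    [ChartedSpace (EuclideanSpace ℝ (Fin l)) L] [IsManifold (𝓡 l) ∞ L] (D : Data n l L) : Prop :=
  ∃ (m : ℕ) (G : Type u) (_ : TopologicalSpace G) (_ : SecondCountableTopology G)
    (_ : ChartedSpace (EuclideanSpace ℝ (Fin m)) G) (_ : IsManifold (𝓡 m) ∞ G)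
    (𝒢 : LieGroupoid m l G L), 𝒢.Integrates D

variable {n d : ℕ} {X : Type u} [TopologicalSpace X]
  [ChartedSpace (EuclideanSpace ℝ (Fin d)) X] [IsManifold (𝓡 d) ∞ X] (D : Data n d X)

/-- `A` is weakly integrable: its restriction to each orbit (with the immersed manifold structure
of the orbit) is integrable. -/
def WeaklyIntegrable : Prop :=
  ∀ x₀ : X, ∃ (l : ℕ) (L : Type u) (_ : TopologicalSpace L) (_ : T2Space L)
    (_ : SecondCountableTopology L) (_ : ChartedSpace (EuclideanSpace ℝ (Fin l)) L)
    (_ : IsManifold (𝓡 l) ∞ L) (ι : L → X) (D' : Data n l L),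
    D.IsLeaf (l := l) x₀ ι ∧ D.IsRestriction ι D' ∧ D'.IsIntegrable

/-- A realization `(M, θ, h)` of the Cartan problem on the `n`-dimensional manifold `M`: a coframe
`θ = (θ^1, …, θ^n)`, seen as a smooth family of isomorphisms `T_p M → ℝⁿ`, and a smooth map
`h : M → X`, with `dθ^k = ∑_{i<j} (C_{ij}^k ∘ h) θ^i ∧ θ^j` and `dh = ∑_i (F_i ∘ h) θ^i`. The
exterior derivative is expressed by
`dθ(V, W) = V(θ(W)) - W(θ(V)) - θ([V, W])` on smooth vector fields `V`, `W`. -/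
structure Realization (M : Type v) [TopologicalSpace M]
    [ChartedSpace (EuclideanSpace ℝ (Fin n)) M] [IsManifold (𝓡 n) ∞ M] where
  θ : ∀ p : M, TangentSpace (𝓡 n) p →L[ℝ] (Fin n → ℝ)
  h : M → X
  smooth_θ : ContMDiff (𝓡 n).tangent 𝓘(ℝ, Fin n → ℝ) ∞
    (fun w : TangentBundle (𝓡 n) M => θ w.proj w.snd)
  smooth_h : ContMDiff (𝓡 n) (𝓡 d) ∞ h
  coframe : ∀ p, Function.Bijective (θ p)
  structure_eq : ∀ V W : ∀ p : M, TangentSpace (𝓡 n) p, SmoothField V → SmoothField W →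
    ∀ (k : Fin n) (p : M),
      mvfderiv (𝓡 n) (fun q => θ q (W q) k) p (V p)
        - mvfderiv (𝓡 n) (fun q => θ q (V q) k) p (W p)
        - θ p (VectorField.mlieBracket (𝓡 n) V W p) k =
      ∑ i, ∑ j, if i < j then
        D.C i j k (h p) * (θ p (V p) i * θ p (W p) j - θ p (W p) i * θ p (V p) j) else 0
  dh_eq : ∀ (p : M) (v : TangentSpace (𝓡 n) p),
    mfderiv (𝓡 n) (𝓡 d) h p v = D.anchor (h p) (θ p v)

variable {D}

/-- The germ of the realization `R₀` at `m₀` is the germ of the realization `R` at `p₀`: a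
diffeomorphism `φ` from a neighbourhood of `m₀` onto a neighbourhood of `p₀` with `φ m₀ = p₀`
satisfies `φ^* θ = θ₀` and `h ∘ φ = h₀`. -/
def Realization.SameGerm {M₀ : Type*} [TopologicalSpace M₀]
    [ChartedSpace (EuclideanSpace ℝ (Fin n)) M₀] [IsManifold (𝓡 n) ∞ M₀]
    {M : Type*} [TopologicalSpace M]
    [ChartedSpace (EuclideanSpace ℝ (Fin n)) M] [IsManifold (𝓡 n) ∞ M]
    (R₀ : D.Realization M₀) (m₀ : M₀) (R : D.Realization M) (p₀ : M) : Prop :=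
  ∃ φ : OpenPartialHomeomorph M₀ M,
    ContMDiffOn (𝓡 n) (𝓡 n) ∞ φ φ.source ∧ ContMDiffOn (𝓡 n) (𝓡 n) ∞ φ.symm φ.target ∧
    m₀ ∈ φ.source ∧ φ m₀ = p₀ ∧
    ∀ q ∈ φ.source, R.h (φ q) = R₀.h q ∧
      ∀ v : TangentSpace (𝓡 n) q, R.θ (φ q) (mfderiv (𝓡 n) (𝓡 n) φ q v) = R₀.θ q v

end Data

end Cartan

end

noncomputable section

open scoped Manifold ContDiff Topology
open Set Metric

attribute [-instance] TopCat.of.chartedSpace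

/-! From the first statement to the second: since `dh = ∑ (F_i ∘ h) θ^i`, the map `h` sends a smooth
curve `c` in a realization to the base of the `A`-path with coefficients `θ(c')`. Hence the orbit of
`h` is locally constant on a realization, so constant on a connected one (`Realization.sameOrbit`),
and germ equivalences preserve the value of `h`.

The converse combines a local uniqueness statement with a construction.

Uniqueness (`Realization.sameGerm_of_h_eq`): the value of `h` at a point determines the germ there.
In charts an equivalence is a solution of `df = θ(f)⁻¹ ∘ θ₀`. The structure equations give the
Frobenius condition only at pairs `(x, y)` with `h₀ x = h y`, which need not be an open set of
pairs, so Frobenius on an open set is not available. The cure is to integrate along rays: along a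
radial solution, `h` and `h₀` trace `A`-paths with equal coefficients and equal starting point, so
they agree by uniqueness for ODEs. Integrability along the radial solutions is already enough for
their endpoints to solve the equation (`hasFDerivAt_of_radial_solutions`), by a Grönwall comparison
that needs no smooth dependence of flows on parameters.

Existence (`WeaklyIntegrable.exists_realization`): let a Lie groupoid integrate the restriction of
`A` to the leaf `ι : L → X`. On the unit component of a source fibre, the coframe dual to the right
invariant fields `R i` (the Maurer-Cartan form) and the map `h = ι ∘ t` form a connected
realization, because `[R_i, R_j] = -∑ C_{ij}^k R_k` and `R_i` is `ι ∘ t`-related to `F_i`. To see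
that `h` is onto the orbit, note that right translations make the images of two such components
equal or disjoint, and that an `A`-path starting in the image of a realization stays there for a
short time, since it lifts by solving `θ(u') = a`. Thus the image containing the current point is
locally constant along an `A`-path, hence constant, and one realization meets both given points.
Uniqueness then identifies the germs. -/

namespace Cartan

/-! ### Total differential equations integrable along radial solutions -/

/-- Second-order Taylor estimate on a convex set where the derivative is Lipschitz. -/
theorem norm_sub_sub_fderiv_le {E G : Type*} [NormedAddCommGroup E] [NormedSpace ℝ E]
    [NormedAddCommGroup G] [NormedSpace ℝ G] {A : E → G} {A' : E → E →L[ℝ] G} {Q : Set E}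
    {K : NNReal} (hQ : Convex ℝ Q) (hA : ∀ q ∈ Q, HasFDerivAt A (A' q) q)
    (hK : LipschitzOnWith K A' Q) {p q : E} (hp : p ∈ Q) (hq : q ∈ Q) :
    ‖A q - A p - A' p (q - p)‖ ≤ K * ‖q - p‖ ^ 2 := by
  have hseg : segment ℝ p q ⊆ Q := hQ.segment_subset hp hq
  have := Convex.norm_image_sub_le_of_norm_hasFDerivWithin_le' (f := A) (f' := A') (φ := A' p)
    (s := segment ℝ p q) (C := K * ‖q - p‖) (x := p) (y := q)
    (fun x hx => (hA x (hseg hx)).hasFDerivWithinAt) ?_ (convex_segment p q)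
    (left_mem_segment ℝ p q) (right_mem_segment ℝ p q)
  · calc _ ≤ _ := this
      _ = _ := by ring
  · intro x hx
    refine (hK.norm_sub_le (hseg hx) hp).trans ?_
    gcongr
    obtain ⟨a, b, ha, hb, hab, rfl⟩ := hx
    have : a • p + b • q - p = b • (q - p) := by
      rw [show a = 1 - b by linarith]; module
    rw [this, norm_smul, Real.norm_of_nonneg hb]
    have : b ≤ 1 := by linarith
    nlinarith [norm_nonneg (q - p)]

/-- Linearity in the error when the initial gap is zero. It turns a residual of size `M * ‖w‖ ^ 2`
into a distance bound whose constant does not depend on `w`. -/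
theorem gronwallBound_zero_mul (K ε x : ℝ) :
    gronwallBound 0 K ε x = ε * gronwallBound 0 K 1 x := by
  unfold gronwallBound
  split_ifs <;> ring

theorem HasDerivWithinAt.Ici_of_Icc {E : Type*} [NormedAddCommGroup E] [NormedSpace ℝ E]
    {f : ℝ → E} {f' : E} {a b t : ℝ} (h : HasDerivWithinAt f f' (Icc a b) t)
    (ht : t ∈ Ico a b) : HasDerivWithinAt f f' (Ici t) t :=
  h.mono_of_mem_nhdsWithin (Icc_mem_nhdsGE_of_mem ht)

theorem HasDerivWithinAt.Iic_of_Icc {E : Type*} [NormedAddCommGroup E] [NormedSpace ℝ E]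
    {f : ℝ → E} {f' : E} {a b t : ℝ} (h : HasDerivWithinAt f f' (Icc a b) t)
    (ht : t ∈ Ioc a b) : HasDerivWithinAt f f' (Iic t) t :=
  h.mono_of_mem_nhdsWithin (Icc_mem_nhdsLE_of_mem ht)

/-- Radial solutions of a total differential equation `df = A(x, f)` satisfying the Frobenius
integrability condition along the radial solution curves solve the equation. -/
theorem hasFDerivAt_of_radial_solutions {E : Type*} [NormedAddCommGroup E] [NormedSpace ℝ E]
    {A : E × E → E →L[ℝ] E} {A' : E × E → E × E →L[ℝ] E →L[ℝ] E} {x₀ y₀ : E} {r ρ : ℝ}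
    {K : NNReal} (hρ : 0 < ρ)
    (hA : ∀ q ∈ closedBall x₀ r ×ˢ closedBall y₀ ρ, HasFDerivAt A (A' q) q)
    (hAK : ∀ q ∈ closedBall x₀ r ×ˢ closedBall y₀ ρ, ‖A q‖ ≤ K)
    (hA'K : ∀ q ∈ closedBall x₀ r ×ˢ closedBall y₀ ρ, ‖A' q‖ ≤ K)
    (hA'L : LipschitzOnWith K A' (closedBall x₀ r ×ˢ closedBall y₀ ρ))
    {u : E → ℝ → E} (hu0 : ∀ x ∈ ball (0 : E) r, u x 0 = y₀)
    (huρ : ∀ x ∈ ball (0 : E) r, ∀ t ∈ Icc (0 : ℝ) 1, u x t ∈ closedBall y₀ (ρ / 2))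
    (hu : ∀ x ∈ ball (0 : E) r, ∀ t ∈ Icc (0 : ℝ) 1,
      HasDerivWithinAt (u x) (A (x₀ + t • x, u x t) x) (Icc 0 1) t)
    {x : E} (hx : x ∈ ball (0 : E) r)
    (hint : ∀ t ∈ Icc (0 : ℝ) 1, ∀ v w : E,
      A' (x₀ + t • x, u x t) (v, A (x₀ + t • x, u x t) v) w =
        A' (x₀ + t • x, u x t) (w, A (x₀ + t • x, u x t) w) v) :
    HasFDerivAt (fun x => u x 1) (A (x₀ + x, u x 1)) x := by
  set Q : Set (E × E) := closedBall x₀ r ×ˢ closedBall y₀ ρ with hQdef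
  have hQconv : Convex ℝ Q := (convex_closedBall x₀ r).prod (convex_closedBall y₀ ρ)
  have hAL : LipschitzOnWith K A Q := hQconv.lipschitzOnWith_of_nnnorm_hasFDerivWithin_le
    (fun q hq => (hA q hq).hasFDerivWithinAt) (fun q hq => hA'K q hq)
  have hr : 0 < r := by
    have := pos_of_mem_ball hx
    exact this
  have hmemx : ∀ y ∈ ball (0 : E) r, ∀ t ∈ Icc (0 : ℝ) 1, x₀ + t • y ∈ closedBall x₀ r := by
    intro y hy t ht
    rw [mem_ball_zero_iff] at hy
    rw [mem_closedBall, dist_eq_norm, add_sub_cancel_left, norm_smul, Real.norm_of_nonneg ht.1]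
    nlinarith [ht.2, norm_nonneg y]
  have hhalf : closedBall y₀ (ρ / 2) ⊆ closedBall y₀ ρ := closedBall_subset_closedBall (by linarith)
  have hmemQ : ∀ y ∈ ball (0 : E) r, ∀ t ∈ Icc (0 : ℝ) 1, (x₀ + t • y, u y t) ∈ Q :=
    fun y hy t ht => ⟨hmemx y hy t ht, hhalf (huρ y hy t ht)⟩
  set M : ℝ := K * (1 + K) ^ 2 * r + K * (1 + K) with hM
  set g : ℝ := gronwallBound 0 (K * r.toNNReal : ℝ) 1 (1 - 0) with hg
  have hkey : ∀ᶠ w in 𝓝 (0 : E),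
      ‖u (x + w) 1 - u x 1 - A (x₀ + x, u x 1) w‖ ≤ (M * g) * ‖w‖ ^ 2 := by
    have h1 : ∀ᶠ w in 𝓝 (0 : E), x + w ∈ ball (0 : E) r := by
      have : ContinuousAt (fun w : E => x + w) 0 := by fun_prop
      exact this.eventually (isOpen_ball.mem_nhds (by simpa using hx))
    have h2 : ∀ᶠ w in 𝓝 (0 : E), K * ‖w‖ < ρ / 2 := by
      have : ContinuousAt (fun w : E => K * ‖w‖) 0 := by fun_prop
      exact this.eventually_lt continuousAt_const (by simpa using hρ)
    filter_upwards [h1, h2] with w hw1 hw2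
    set q : ℝ → E × E := fun t => (x₀ + t • x, u x t) with hq
    -- If the endpoints did define a solution `f`, the curve for the direction `x + w` would be `f
    -- (x₀ + t • (x + w))`; `z` is its first-order expansion around `t • x`. It is compared with the
    -- true curve `u (x + w)` by Grönwall, and `z 1` is the affine approximation to be proved.
    set z : ℝ → E := fun t => u x t + t • A (q t) w with hz
    set z' : ℝ → E := fun t => A (q t) x + (A (q t) w + t • A' (q t) (x, A (q t) x) w) with hz'
    have hqd : ∀ t ∈ Icc (0 : ℝ) 1, HasDerivWithinAt q (x, A (q t) x) (Icc 0 1) t := by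
      intro t ht
      have ha : HasDerivWithinAt (fun t : ℝ => x₀ + t • x) x (Icc 0 1) t := by
        simpa using ((hasDerivWithinAt_id t (Icc (0 : ℝ) 1)).smul_const x).const_add x₀
      exact ha.prodMk (hu x hx t ht)
    have hzd : ∀ t ∈ Icc (0 : ℝ) 1, HasDerivWithinAt z (z' t) (Icc 0 1) t := by
      intro t ht
      have hAq : HasDerivWithinAt (fun t => A (q t)) (A' (q t) (x, A (q t) x)) (Icc 0 1) t :=
        (hA (q t) (hmemQ x hx t ht)).comp_hasDerivWithinAt t (hqd t ht)
      have hAqw : HasDerivWithinAt (fun t => A (q t) w) (A' (q t) (x, A (q t) x) w) (Icc 0 1) t := by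
        simpa using hAq.clm_apply (hasDerivWithinAt_const t (Icc (0 : ℝ) 1) w)
      have := (hu x hx t ht).add ((hasDerivWithinAt_id t (Icc (0 : ℝ) 1)).smul hAqw)
      refine this.congr_deriv ?_
      simp only [hz', hq, id, one_smul]
      abel
    have hAw : ∀ t ∈ Icc (0 : ℝ) 1, ‖A (q t) w‖ ≤ K * ‖w‖ := fun t ht =>
      (A (q t)).le_of_opNorm_le (hAK _ (hmemQ x hx t ht)) w
    have hzs : ∀ t ∈ Icc (0 : ℝ) 1, z t ∈ closedBall y₀ ρ := by
      intro t ht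
      have h3 := huρ x hx t ht
      rw [mem_closedBall, dist_eq_norm] at h3 ⊢
      calc ‖z t - y₀‖ = ‖(u x t - y₀) + t • A (q t) w‖ := by simp only [hz]; congr 1; abel
        _ ≤ ‖u x t - y₀‖ + ‖t • A (q t) w‖ := norm_add_le _ _
        _ ≤ ρ / 2 + 1 * (K * ‖w‖) := by
          rw [norm_smul, Real.norm_of_nonneg ht.1]
          gcongr
          exacts [ht.2, hAw t ht]
        _ ≤ ρ := by linarith
    have hlip : ∀ t ∈ Ico (0 : ℝ) 1, LipschitzOnWith (K * r.toNNReal)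
        (fun y => A (x₀ + t • (x + w), y) (x + w)) (closedBall y₀ ρ) := by
      intro t ht
      refine LipschitzOnWith.of_dist_le_mul fun y₁ hy₁ y₂ hy₂ => ?_
      have hxt := hmemx _ hw1 t (Ico_subset_Icc_self ht)
      rw [dist_eq_norm, ← _root_.sub_apply]
      calc _ ≤ ‖A (x₀ + t • (x + w), y₁) - A (x₀ + t • (x + w), y₂)‖ * ‖x + w‖ :=
            ContinuousLinearMap.le_opNorm _ _
        _ ≤ (K * dist y₁ y₂) * r := by
            gcongr
            · have := hAL.norm_sub_le (x := (x₀ + t • (x + w), y₁)) ⟨hxt, hy₁⟩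
                (y := (x₀ + t • (x + w), y₂)) ⟨hxt, hy₂⟩
              simpa [Prod.norm_def, dist_eq_norm] using this
            · exact (mem_ball_zero_iff.1 hw1).le
        _ = _ := by
          rw [NNReal.coe_mul, Real.coe_toNNReal _ hr.le]; ring
    have hres : ∀ t ∈ Ico (0 : ℝ) 1,
        dist (z' t) (A (x₀ + t • (x + w), z t) (x + w)) ≤ M * ‖w‖ ^ 2 := by
      intro t ht'
      have ht := Ico_subset_Icc_self ht'
      set δ : E × E := (w, A (q t) w) with hδ
      have hδn : ‖δ‖ ≤ (1 + K) * ‖w‖ := by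
        rw [Prod.norm_def]
        refine max_le ?_ ((hAw t ht).trans ?_)
        · simp only [hδ]; nlinarith [norm_nonneg w, K.2]
        · nlinarith [norm_nonneg w, K.2]
      have hq' : (x₀ + t • (x + w), z t) = q t + t • δ := by
        simp only [hq, hz, hδ, Prod.smul_mk, Prod.mk_add_mk, smul_add]
        congr 1
        abel
      have hqQ := hmemQ x hx t ht
      have hq'Q : q t + t • δ ∈ Q := by
        rw [← hq']; exact ⟨hmemx _ hw1 t ht, hzs t ht⟩
      have htay := norm_sub_sub_fderiv_le hQconv hA hA'L hqQ hq'Q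
      rw [add_sub_cancel_left] at htay
      have hi := hint t ht x w
      -- The Frobenius condition replaces the derivative term of `z'` by `A' (q t) δ x`, which
      -- cancels the first-order Taylor term. What remains, a Taylor remainder and `A' (q t) δ w`,
      -- is quadratic in `w`; these two give the two summands of `M`.
      have heq : z' t - A (x₀ + t • (x + w), z t) (x + w) =
          -((A (q t + t • δ) - A (q t) - A' (q t) (t • δ)) (x + w)) - t • A' (q t) δ w := by
        rw [hq']
        simp only [hz', map_smul, _root_.sub_apply, map_add,
          _root_.smul_apply]
        have hi' : (A' (q t)) (x, A (q t) x) w = A' (q t) δ x := hi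
        rw [hi']
        abel
      have htδ : ‖t • δ‖ ≤ (1 + K) * ‖w‖ := by
        rw [norm_smul, Real.norm_of_nonneg ht.1]
        calc t * ‖δ‖ ≤ 1 * ‖δ‖ := by gcongr; exact ht.2
          _ ≤ _ := by rw [one_mul]; exact hδn
      rw [dist_eq_norm, heq]
      calc _ ≤ ‖(A (q t + t • δ) - A (q t) - A' (q t) (t • δ)) (x + w)‖ + ‖t • A' (q t) δ w‖ := by
            refine (norm_sub_le _ _).trans ?_
            rw [norm_neg]
        _ ≤ (K * ((1 + K) * ‖w‖) ^ 2) * r + 1 * ((K * ((1 + K) * ‖w‖)) * ‖w‖) := by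
            refine add_le_add ?_ ?_
            · refine (ContinuousLinearMap.le_opNorm _ _).trans ?_
              gcongr
              · refine htay.trans ?_
                gcongr
              · exact (mem_ball_zero_iff.1 hw1).le
            · rw [norm_smul, Real.norm_of_nonneg ht.1]
              gcongr
              · exact ht.2
              · refine (ContinuousLinearMap.le_opNorm _ _).trans ?_
                gcongr
                refine (ContinuousLinearMap.le_opNorm _ _).trans ?_
                gcongr
                exact hA'K _ hqQ
        _ = _ := by rw [hM]; ring
    have hmain := dist_le_of_approx_trajectories_ODE_of_mem (δ := 0)
      (v := fun t y => A (x₀ + t • (x + w), y) (x + w)) (s := fun _ => closedBall y₀ ρ)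
      (f := z) (f' := z') (g := u (x + w)) (εf := M * ‖w‖ ^ 2) (εg := 0)
      (g' := fun t => A (x₀ + t • (x + w), u (x + w) t) (x + w))
      hlip (fun t ht => (hzd t ht).continuousWithinAt)
      (fun t ht => HasDerivWithinAt.Ici_of_Icc (hzd t (Ico_subset_Icc_self ht)) ht) hres
      (fun t ht => hzs t (Ico_subset_Icc_self ht))
      (fun t ht => (hu _ hw1 t ht).continuousWithinAt)
      (fun t ht => HasDerivWithinAt.Ici_of_Icc (hu _ hw1 t (Ico_subset_Icc_self ht)) ht)
      (fun t _ => by rw [dist_self]) (fun t ht => hhalf (huρ _ hw1 t (Ico_subset_Icc_self ht)))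
      (by simp [hz, hu0 x hx, hu0 _ hw1]) 1 (by simp)
    rw [add_zero, gronwallBound_zero_mul, dist_comm, dist_eq_norm] at hmain
    have : u (x + w) 1 - z 1 = u (x + w) 1 - u x 1 - A (x₀ + x, u x 1) w := by
      simp only [hz, hq, one_smul]; abel
    rw [this] at hmain
    calc _ ≤ _ := hmain
      _ = _ := by rw [hg, NNReal.coe_mul]; ring
  rw [hasFDerivAt_iff_isLittleO_nhds_zero]
  refine Asymptotics.IsBigO.trans_isLittleO (g := fun w : E => ‖w‖ ^ 2) ?_ ?_
  · refine Asymptotics.IsBigO.of_bound (M * g) ?_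
    filter_upwards [hkey] with w hw
    simpa using hw
  · simpa using (Asymptotics.isLittleO_norm_pow_id (E' := E) one_lt_two)

/-- The Picard-Lindelöf theorem, with the information that the solution stays in the ball. -/
theorem exists_solution_mem_closedBall {E : Type*} [NormedAddCommGroup E] [NormedSpace ℝ E]
    [CompleteSpace E] {f : ℝ → E → E} {tmin tmax : ℝ} {t₀ : Icc tmin tmax} {x₀ : E}
    {a L K : NNReal} (hf : IsPicardLindelof f t₀ x₀ a 0 L K) :
    ∃ α : ℝ → E, α t₀ = x₀ ∧ ∀ t ∈ Icc tmin tmax,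
      HasDerivWithinAt α (f t (α t)) (Icc tmin tmax) t ∧ α t ∈ closedBall x₀ a := by
  have hx : x₀ ∈ closedBall x₀ ((0 : NNReal) : ℝ) := mem_closedBall_self le_rfl
  obtain ⟨α, hα⟩ := ODE.FunSpace.exists_isFixedPt_next hf hx
  refine ⟨α.compProj, by rw [ODE.FunSpace.compProj_val, ← hα, ODE.FunSpace.next_apply₀],
    fun t ht ↦ ⟨?_, α.compProj_mem_closedBall hf.mul_max_le⟩⟩
  apply ODE.hasDerivWithinAt_picard_Icc t₀.2 hf.continuousOn_uncurry
    α.continuous_compProj.continuousOn (fun _ ht' ↦ α.compProj_mem_closedBall hf.mul_max_le)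
    x₀ ht |>.congr_of_mem _ ht
  intro t' ht'
  nth_rw 1 [← hα]
  rw [ODE.FunSpace.compProj_of_mem ht', ODE.FunSpace.next_apply]

/-- `u` is a radial solution of `df = A(x, f)` in the direction `x` from `(x₀, y₀)`. -/
structure IsRadialSolution {E : Type*} [NormedAddCommGroup E] [NormedSpace ℝ E]
    (A : E × E → E →L[ℝ] E) (W : Set (E × E)) (x₀ y₀ x : E) (u : ℝ → E) : Prop where
  zero : u 0 = y₀
  mem : ∀ t ∈ Icc (0 : ℝ) 1, (x₀ + t • x, u t) ∈ W
  deriv : ∀ t ∈ Icc (0 : ℝ) 1, HasDerivWithinAt u (A (x₀ + t • x, u t) x) (Icc 0 1) t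

/-- Local solvability of the total differential equation `df = A(x, f)` when the Frobenius
condition holds along radial solutions. -/
theorem exists_solution_of_frobenius {E : Type*} [NormedAddCommGroup E] [NormedSpace ℝ E]
    [FiniteDimensional ℝ E] {A : E × E → E →L[ℝ] E} {W : Set (E × E)} (hW : IsOpen W)
    (hA : ContDiffOn ℝ ∞ A W) {x₀ y₀ : E} (h0 : (x₀, y₀) ∈ W)
    (hint : ∀ x u, IsRadialSolution A W x₀ y₀ x u → ∀ t ∈ Icc (0 : ℝ) 1, ∀ v w : E,
      fderiv ℝ A (x₀ + t • x, u t) (v, A (x₀ + t • x, u t) v) w =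
        fderiv ℝ A (x₀ + t • x, u t) (w, A (x₀ + t • x, u t) w) v) :
    ∃ (f : E → E) (r : ℝ), 0 < r ∧ f x₀ = y₀ ∧ ContDiffOn ℝ ∞ f (ball x₀ r) ∧
      ∀ x ∈ ball x₀ r, (x, f x) ∈ W ∧ HasFDerivAt f (A (x, f x)) x ∧
        ∃ u, IsRadialSolution A W x₀ y₀ (x - x₀) u ∧ u 1 = f x := by
  have hproper : ProperSpace E := FiniteDimensional.proper_real E
  have hcomplete : CompleteSpace E := FiniteDimensional.complete ℝ E
  obtain ⟨R, hR, hRW⟩ : ∃ R > 0, closedBall x₀ R ×ˢ closedBall y₀ R ⊆ W := by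
    obtain ⟨R, hR, h⟩ := Metric.nhds_basis_closedBall.mem_iff.1 (hW.mem_nhds h0)
    exact ⟨R, hR, by rwa [closedBall_prod_same]⟩
  set Q : Set (E × E) := closedBall x₀ R ×ˢ closedBall y₀ R with hQ
  have hQc : IsCompact Q := (isCompact_closedBall x₀ R).prod (isCompact_closedBall y₀ R)
  have hQconv : Convex ℝ Q := (convex_closedBall x₀ R).prod (convex_closedBall y₀ R)
  have hA' : ContDiffOn ℝ ∞ (fderiv ℝ A) W := ((contDiffOn_infty_iff_fderiv_of_isOpen hW).1 hA).2
  obtain ⟨K₁, hK₁⟩ := (hA'.mono hRW).exists_lipschitzOnWith (by simp) hQconv hQc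
  obtain ⟨K₂, hK₂⟩ := hQc.exists_bound_of_continuousOn (hA.continuousOn.mono hRW)
  obtain ⟨K₃, hK₃⟩ : ∃ K₃ : ℝ, ∀ q ∈ Q, ‖fderiv ℝ A q‖ ≤ K₃ := by
    refine ⟨K₁ * R + ‖fderiv ℝ A (x₀, y₀)‖, fun q hq => ?_⟩
    have h1 := hK₁.norm_sub_le hq (y := (x₀, y₀))
      ⟨mem_closedBall_self hR.le, mem_closedBall_self hR.le⟩
    have h2 : ‖q - (x₀, y₀)‖ ≤ R := by
      rw [← dist_eq_norm, ← mem_closedBall, ← closedBall_prod_same]; exact hq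
    have h3 := norm_le_norm_sub_add (fderiv ℝ A q) (fderiv ℝ A (x₀, y₀))
    have h4 : K₁ * ‖q - (x₀, y₀)‖ ≤ K₁ * R := by gcongr
    linarith
  obtain ⟨K, hKK₁, hKK₂, hKK₃⟩ : ∃ K : NNReal, K₁ ≤ K ∧ K₂ ≤ K ∧ K₃ ≤ K :=
    ⟨max K₁ (max K₂.toNNReal K₃.toNNReal), le_max_left _ _,
      (Real.le_coe_toNNReal _).trans (by exact_mod_cast (le_max_left _ _).trans (le_max_right _ _)),
      (Real.le_coe_toNNReal _).trans
        (by exact_mod_cast (le_max_right _ _).trans (le_max_right _ _))⟩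
  have hbA : ∀ q ∈ Q, ‖A q‖ ≤ K := fun q hq => (hK₂ q hq).trans hKK₂
  have hbA' : ∀ q ∈ Q, ‖fderiv ℝ A q‖ ≤ K := fun q hq => (hK₃ q hq).trans hKK₃
  have hdA : ∀ q ∈ Q, HasFDerivAt A (fderiv ℝ A q) q := fun q hq =>
    ((hA.differentiableOn (by simp)).differentiableAt (hW.mem_nhds (hRW hq))).hasFDerivAt
  have hAL : LipschitzOnWith K A Q := hQconv.lipschitzOnWith_of_nnnorm_hasFDerivWithin_le
    (fun q hq => (hdA q hq).hasFDerivWithinAt) (fun q hq => hbA' q hq)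
  -- The radial speed is at most `K * r ≤ R / 2`, so solutions exist up to time 1 and stay in the
  -- ball of half the radius. The other half is room for the approximate trajectories in
  -- `hasFDerivAt_of_radial_solutions`.
  set r : ℝ := min R (R / (2 * (K + 1))) with hr
  have hK0 : (0 : ℝ) ≤ K := K.2
  have hrpos : 0 < r := lt_min hR (by positivity)
  have hrR : r ≤ R := min_le_left _ _
  have hKr : K * r ≤ R / 2 := by
    calc K * r ≤ (K + 1) * (R / (2 * (K + 1))) := by
          gcongr
          · linarith
          · exact min_le_right _ _
      _ = R / 2 := by field_simp
  have hmemx : ∀ y ∈ ball (0 : E) r, ∀ t ∈ Icc (0 : ℝ) 1, x₀ + t • y ∈ closedBall x₀ r := by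
    intro y hy t ht
    rw [mem_ball_zero_iff] at hy
    rw [mem_closedBall, dist_eq_norm, add_sub_cancel_left, norm_smul, Real.norm_of_nonneg ht.1]
    nlinarith [ht.2, norm_nonneg y]
  have hsub : closedBall x₀ r ×ˢ closedBall y₀ R ⊆ Q :=
    prod_mono (closedBall_subset_closedBall hrR) le_rfl
  have hhalf : closedBall y₀ (R / 2) ⊆ closedBall y₀ R := closedBall_subset_closedBall (by linarith)
  have hex : ∀ x : E, ∃ u : ℝ → E, x ∈ ball (0 : E) r → u 0 = y₀ ∧ ∀ t ∈ Icc (0 : ℝ) 1,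
      HasDerivWithinAt u (A (x₀ + t • x, u t) x) (Icc 0 1) t ∧ u t ∈ closedBall y₀ (R / 2) := by
    intro x
    by_cases hx : x ∈ ball (0 : E) r
    · have hxr : ‖x‖ ≤ r := (mem_ball_zero_iff.1 hx).le
      have hp : IsPicardLindelof (fun t y => A (x₀ + t • x, y) x)
          (⟨0, by simp⟩ : Icc (0 : ℝ) 1) y₀ (R / 2).toNNReal 0 (K * r.toNNReal)
          (K * r.toNNReal) := by
        have hR2 : ((R / 2).toNNReal : ℝ) = R / 2 := Real.coe_toNNReal _ (by positivity)
        have hr2 : (r.toNNReal : ℝ) = r := Real.coe_toNNReal _ hrpos.le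
        refine ⟨fun t ht => ?_, fun y hy => ?_, fun t ht y hy => ?_, ?_⟩
        · refine LipschitzOnWith.of_dist_le_mul fun y₁ hy₁ y₂ hy₂ => ?_
          rw [hR2] at hy₁ hy₂
          rw [dist_eq_norm, ← _root_.sub_apply]
          calc _ ≤ ‖A (x₀ + t • x, y₁) - A (x₀ + t • x, y₂)‖ * ‖x‖ :=
                ContinuousLinearMap.le_opNorm _ _
            _ ≤ (K * dist y₁ y₂) * r := by
                gcongr
                have := hAL.norm_sub_le (x := (x₀ + t • x, y₁)) (hsub ⟨hmemx x hx t ht, hhalf hy₁⟩)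
                  (y := (x₀ + t • x, y₂)) (hsub ⟨hmemx x hx t ht, hhalf hy₂⟩)
                simpa [Prod.norm_def, dist_eq_norm] using this
            _ = _ := by rw [NNReal.coe_mul, hr2]; ring
        · rw [hR2] at hy
          have hAc := hA.continuousOn.mono hRW
          have : ContinuousOn (fun t : ℝ => A (x₀ + t • x, y)) (Icc 0 1) :=
            hAc.comp (by fun_prop) fun t ht => hsub ⟨hmemx x hx t ht, hhalf hy⟩
          exact this.clm_apply continuousOn_const
        · rw [hR2] at hy
          rw [NNReal.coe_mul, hr2]
          refine (ContinuousLinearMap.le_opNorm _ _).trans ?_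
          gcongr
          exact hbA _ (hsub ⟨hmemx x hx t ht, hhalf hy⟩)
        · rw [NNReal.coe_mul, hr2, hR2]
          simpa using hKr
      obtain ⟨u, hu0, hu⟩ := exists_solution_mem_closedBall hp
      refine ⟨u, fun _ => ⟨hu0, fun t ht => ⟨(hu t ht).1, ?_⟩⟩⟩
      have := (hu t ht).2
      rwa [Real.coe_toNNReal _ (by positivity)] at this
    -- A default outside the ball, so that `choose` yields a family indexed by all of `E`.
    · exact ⟨fun _ => 0, fun h => (hx h).elim⟩
  choose u hu using hex
  have hrad : ∀ x ∈ ball (0 : E) r, IsRadialSolution A W x₀ y₀ x (u x) := fun x hx =>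
    ⟨(hu x hx).1, fun t ht => hRW (hsub ⟨hmemx x hx t ht, hhalf ((hu x hx).2 t ht).2⟩),
      fun t ht => ((hu x hx).2 t ht).1⟩
  have hder : ∀ x ∈ ball (0 : E) r, HasFDerivAt (fun x => u x 1) (A (x₀ + x, u x 1)) x := by
    intro x hx
    exact hasFDerivAt_of_radial_solutions (r := r) hR (fun q hq => hdA q (hsub hq))
      (fun q hq => hbA q (hsub hq)) (fun q hq => hbA' q (hsub hq))
      ((hK₁.mono hsub).weaken hKK₁) (fun x hx => (hu x hx).1)
      (fun x hx t ht => ((hu x hx).2 t ht).2) (fun x hx t ht => ((hu x hx).2 t ht).1) hx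
      (hint x (u x) (hrad x hx))
  have hball : ∀ x ∈ ball x₀ r, x - x₀ ∈ ball (0 : E) r := fun x hx => by
    rwa [mem_ball_zero_iff, ← dist_eq_norm]
  set f : E → E := fun x => u (x - x₀) 1 with hf
  have hfW : ∀ x ∈ ball x₀ r, (x, f x) ∈ W := by
    intro x hx
    have := (hrad _ (hball x hx)).mem 1 (by simp)
    rwa [one_smul, add_sub_cancel] at this
  have hfd : ∀ x ∈ ball x₀ r, HasFDerivAt f (A (x, f x)) x := by
    intro x hx
    have := (hder _ (hball x hx)).comp x ((hasFDerivAt_id x).sub_const x₀)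
    rw [add_sub_cancel] at this
    exact this
  -- Bootstrapping: if `f` is of class `C^k`, so is its derivative `A (x, f x)`, hence `f` is of
  -- class `C^(k+1)`.
  have hsm : ∀ k : ℕ, ContDiffOn ℝ k f (ball x₀ r) := by
    intro k
    induction k with
    | zero =>
      rw [Nat.cast_zero, contDiffOn_zero]
      exact fun x hx => (hfd x hx).continuousAt.continuousWithinAt
    | succ k ih =>
      rw [Nat.cast_succ, contDiffOn_succ_iff_fderiv_of_isOpen isOpen_ball]
      refine ⟨fun x hx => (hfd x hx).differentiableAt.differentiableWithinAt, by simp, ?_⟩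
      refine ContDiffOn.congr (f := fun x => A (x, f x)) ?_ fun x hx => (hfd x hx).fderiv
      exact (hA.of_le (by exact_mod_cast le_top)).comp (contDiffOn_id.prodMk ih) hfW
  refine ⟨f, r, hrpos, ?_, contDiffOn_infty.2 hsm, fun x hx => ⟨hfW x hx, hfd x hx, u (x - x₀),
    hrad _ (hball x hx), rfl⟩⟩
  have h00 : (0 : E) ∈ ball (0 : E) r := by simpa using hrpos
  have hz := hu 0 h00
  -- The radial solution in the direction `0` has zero velocity, which gives `f x₀ = y₀`.
  have hconst : ∀ t ∈ Icc (0 : ℝ) 1, u 0 t = u 0 0 := by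
    refine constant_of_has_deriv_right_zero
      (fun t ht => ((hz.2 t ht).1).continuousWithinAt) fun t ht => ?_
    have := HasDerivWithinAt.Ici_of_Icc ((hz.2 t (Ico_subset_Icc_self ht)).1) ht
    simpa using this
  simp only [hf, sub_self]
  rw [hconst 1 (by simp), hz.1]

/-! ### Local equivalence of coframes on a vector space -/

section
variable {E F : Type*} [NormedAddCommGroup E] [NormedSpace ℝ E] [NormedAddCommGroup F]
  [NormedSpace ℝ F]

/-- The form `θ` on a vector space satisfies `dθ = c(θ, θ)` at `y`. -/
def CurlEq (θ : E → E →L[ℝ] F) (c : F → F → F) (y : E) : Prop :=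
  ∀ v w : E, fderiv ℝ θ y v w - fderiv ℝ θ y w v = c (θ y v) (θ y w)

/-- The linear map identifying two coframes `θ₀` at `q.1` and `θ` at `q.2`. -/
def coframeMap (θ₀ θ : E → E →L[ℝ] F) (q : E × E) : E →L[ℝ] E :=
  (θ q.2).inverse ∘L θ₀ q.1

/-- This is what makes `df = coframeMap θ₀ θ (x, f x)` the equation `f^* θ = θ₀`. -/
theorem apply_coframeMap {θ₀ θ : E → E →L[ℝ] F} {q : E × E} (h : (θ q.2).IsInvertible) (v : E) :
    θ q.2 (coframeMap θ₀ θ q v) = θ₀ q.1 v := by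
  obtain ⟨e, he⟩ := h
  simp [coframeMap, ← he]

theorem contDiffOn_coframeMap [CompleteSpace E] {θ₀ θ : E → E →L[ℝ] F} {U₀ U : Set E}
    (hθ₀ : ContDiffOn ℝ ∞ θ₀ U₀) (hθ : ContDiffOn ℝ ∞ θ U)
    (hinv : ∀ y ∈ U, (θ y).IsInvertible) :
    ContDiffOn ℝ ∞ (coframeMap θ₀ θ) (U₀ ×ˢ U) := by
  have h1 : ContDiffOn ℝ ∞ (fun q : E × E => (θ q.2).inverse) (U₀ ×ˢ U) := by
    have h2 : ContDiffOn ℝ ∞ (fun y => (θ y).inverse) U := by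
      intro y hy
      obtain ⟨e, he⟩ := hinv y hy
      have h3 : ContDiffAt ℝ ∞ ContinuousLinearMap.inverse (θ y) := he ▸ contDiffAt_map_inverse e
      exact h3.comp_contDiffWithinAt y (hθ y hy)
    exact h2.comp contDiff_snd.contDiffOn fun q hq => hq.2
  exact h1.clm_comp (hθ₀.comp contDiff_fst.contDiffOn fun q hq => hq.1)

/-- The curl equations of two coframes give the Frobenius condition for `df = coframeMap (x, f)`. -/
theorem frobenius_of_curlEq [CompleteSpace E] {θ₀ θ : E → E →L[ℝ] F} {U₀ U : Set E}
    (hU₀ : IsOpen U₀) (hU : IsOpen U)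
    (hθ₀ : ContDiffOn ℝ ∞ θ₀ U₀) (hθ : ContDiffOn ℝ ∞ θ U)
    (hinv : ∀ y ∈ U, (θ y).IsInvertible) {x y : E} (hx : x ∈ U₀) (hy : y ∈ U)
    {c : F → F → F} (hc₀ : CurlEq θ₀ c x) (hc : CurlEq θ c y) (v w : E) :
    fderiv ℝ (coframeMap θ₀ θ) (x, y) (v, coframeMap θ₀ θ (x, y) v) w =
      fderiv ℝ (coframeMap θ₀ θ) (x, y) (w, coframeMap θ₀ θ (x, y) w) v := by
  set A := coframeMap θ₀ θ with hA
  have hAd : HasFDerivAt A (fderiv ℝ A (x, y)) (x, y) :=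
    (((contDiffOn_coframeMap hθ₀ hθ hinv).differentiableOn (by simp)).differentiableAt
      ((hU₀.prod hU).mem_nhds ⟨hx, hy⟩)).hasFDerivAt
  have hθ₀d : HasFDerivAt θ₀ (fderiv ℝ θ₀ x) x :=
    ((hθ₀.differentiableOn (by simp)).differentiableAt (hU₀.mem_nhds hx)).hasFDerivAt
  have hθd : HasFDerivAt θ (fderiv ℝ θ y) y :=
    ((hθ.differentiableOn (by simp)).differentiableAt (hU.mem_nhds hy)).hasFDerivAt
  -- Obtained by differentiating `θ q.2 (A q b) = θ₀ q.1 b`. Antisymmetrizing it in the two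
  -- directions leaves the difference of the two curls, which agree because both coframes satisfy
  -- the curl equation with the same `c`.
  have key : ∀ a a' b : E, θ y (fderiv ℝ A (x, y) (a, a') b) =
      fderiv ℝ θ₀ x a b - fderiv ℝ θ y a' (A (x, y) b) := by
    intro a a' b
    have h1 : HasFDerivAt (fun q : E × E => θ q.2 (A q b)) _ (x, y) :=
      (hθd.comp (x, y) hasFDerivAt_snd).clm_apply (hAd.clm_apply (hasFDerivAt_const b (x, y)))
    have h2 : HasFDerivAt (fun q : E × E => θ₀ q.1 b) _ (x, y) :=
      (hθ₀d.comp (x, y) hasFDerivAt_fst).clm_apply (hasFDerivAt_const b (x, y))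
    have h3 : (fun q : E × E => θ q.2 (A q b)) =ᶠ[𝓝 (x, y)] fun q => θ₀ q.1 b := by
      filter_upwards [(hU₀.prod hU).mem_nhds ⟨hx, hy⟩] with q hq
      exact apply_coframeMap (hinv _ hq.2) b
    have h4 := DFunLike.congr_fun (h1.unique (h2.congr_of_eventuallyEq h3)) (a, a')
    simp at h4
    rw [← h4]
    abel
  obtain ⟨e, he⟩ := hinv y hy
  have hinj : Function.Injective (θ y) := by rw [← he]; exact e.injective
  have hav : ∀ a, θ y (A (x, y) a) = θ₀ x a := fun a =>
    apply_coframeMap (q := (x, y)) (hinv y hy) a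
  apply hinj
  rw [key, key]
  have h1 := hc₀ v w
  have h2 := hc (A (x, y) v) (A (x, y) w)
  rw [hav, hav, ← h1] at h2
  rw [sub_eq_sub_iff_add_eq_add] at h2 ⊢
  rw [← h2, add_comm]

/-- Two coframes on open sets of a vector space which satisfy the same structure equations along
corresponding radial curves are locally equivalent. -/
theorem exists_local_equivalence [FiniteDimensional ℝ E] {X : Type*} {H₀ H : E → X}
    {c : X → F → F → F} {θ₀ θ : E → E →L[ℝ] F} {U₀ U : Set E}
    (hU₀ : IsOpen U₀) (hU : IsOpen U)
    (hθ₀ : ContDiffOn ℝ ∞ θ₀ U₀) (hθ : ContDiffOn ℝ ∞ θ U)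
    (hinv₀ : ∀ y ∈ U₀, (θ₀ y).IsInvertible) (hinv : ∀ y ∈ U, (θ y).IsInvertible)
    (hc₀ : ∀ x ∈ U₀, CurlEq θ₀ (c (H₀ x)) x) (hc : ∀ y ∈ U, CurlEq θ (c (H y)) y)
    {x₀ y₀ : E} (hx₀ : x₀ ∈ U₀) (hy₀ : y₀ ∈ U)
    (hH : ∀ (x : E) (u : ℝ → E), u 0 = y₀ →
      (∀ t ∈ Icc (0 : ℝ) 1, x₀ + t • x ∈ U₀ ∧ u t ∈ U ∧
        ∃ u', HasDerivWithinAt u u' (Icc 0 1) t ∧ θ (u t) u' = θ₀ (x₀ + t • x) x) →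
      ∀ t ∈ Icc (0 : ℝ) 1, H (u t) = H₀ (x₀ + t • x)) :
    ∃ f : OpenPartialHomeomorph E E, x₀ ∈ f.source ∧ f x₀ = y₀ ∧ f.source ⊆ U₀ ∧
      f.target ⊆ U ∧ ContDiffOn ℝ ∞ f f.source ∧ ContDiffOn ℝ ∞ f.symm f.target ∧
      ∀ x ∈ f.source, H (f x) = H₀ x ∧ ∀ v, θ (f x) (fderiv ℝ f x v) = θ₀ x v := by
  have hcomplete : CompleteSpace E := FiniteDimensional.complete ℝ E
  set A := coframeMap θ₀ θ with hA
  have hWo : IsOpen (U₀ ×ˢ U) := hU₀.prod hU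
  have hrad : ∀ x u, IsRadialSolution A (U₀ ×ˢ U) x₀ y₀ x u →
      ∀ t ∈ Icc (0 : ℝ) 1, H (u t) = H₀ (x₀ + t • x) := by
    intro x u hu
    refine hH x u hu.zero fun t ht => ⟨(hu.mem t ht).1, (hu.mem t ht).2, _, hu.deriv t ht, ?_⟩
    exact apply_coframeMap (q := (x₀ + t • x, u t)) (hinv _ (hu.mem t ht).2) x
  obtain ⟨f, r, hr, hf0, hfs, hf⟩ := exists_solution_of_frobenius hWo
    (contDiffOn_coframeMap hθ₀ hθ hinv) (x₀ := x₀) (y₀ := y₀) ⟨hx₀, hy₀⟩ (by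
      intro x u hu t ht v w
      have hm := hu.mem t ht
      -- Along a radial solution `H` and `H₀` agree by `hrad`, so both curl equations have the same
      -- right-hand side. This may fail at other points of `U₀ ×ˢ U`.
      refine frobenius_of_curlEq hU₀ hU hθ₀ hθ hinv hm.1 hm.2 (c := c (H (u t))) ?_ (hc _ hm.2) v w
      rw [hrad x u hu t ht]
      exact hc₀ _ hm.1)
  -- The differential of `f` is invertible on the whole ball, not only at `x₀`: the inverse function
  -- theorem uses `x₀`, while smoothness of the inverse is checked at every point of the target.
  have hAinv : ∀ x ∈ ball x₀ r, ∃ e : E ≃L[ℝ] E, (e : E →L[ℝ] E) = A (x, f x) := by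
    intro x hx
    obtain ⟨e₀, he₀⟩ := hinv₀ x (hf x hx).1.1
    obtain ⟨e, he⟩ := hinv (f x) (hf x hx).1.2
    exact ⟨e₀.trans e.symm, by rw [hA, coframeMap, ← he₀, ← he]; ext; simp⟩
  have hx₀r : x₀ ∈ ball x₀ r := mem_ball_self hr
  have hca : ∀ x ∈ ball x₀ r, ContDiffAt ℝ ∞ f x := fun x hx =>
    hfs.contDiffAt (isOpen_ball.mem_nhds hx)
  obtain ⟨e, he⟩ := hAinv x₀ hx₀r
  have hfe : HasFDerivAt f (e : E →L[ℝ] E) x₀ := he ▸ (hf x₀ hx₀r).2.1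
  set g := ((hca x₀ hx₀r).toOpenPartialHomeomorph f hfe (by simp)).restrOpen (ball x₀ r) isOpen_ball
    with hg
  have hgf : ∀ x, g x = f x := fun x => rfl
  have hgs : g.source ⊆ ball x₀ r := by
    rw [hg, OpenPartialHomeomorph.restrOpen_source]; exact inter_subset_right
  have hgcoe : (g : E → E) = f := rfl
  refine ⟨g, ?_, hf0, fun x hx => (hf x (hgs hx)).1.1, ?_, ?_, ?_, ?_⟩
  · rw [hg, OpenPartialHomeomorph.restrOpen_source]
    exact ⟨(hca x₀ hx₀r).mem_toOpenPartialHomeomorph_source hfe (by simp), hx₀r⟩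
  · intro y hy
    have := (hf _ (hgs (g.map_target hy))).1.2
    rwa [← hgf, g.right_inv hy] at this
  · rw [hgcoe]; exact hfs.mono hgs
  · intro y hy
    have hm := hgs (g.map_target hy)
    obtain ⟨e', he'⟩ := hAinv _ hm
    refine (g.contDiffAt_symm (f₀' := e') hy ?_ ?_).contDiffWithinAt
    · rw [hgcoe, he']; exact (hf _ hm).2.1
    · rw [hgcoe]; exact hca _ hm
  · intro x hx
    obtain ⟨hxW, hxd, u, hu, hu1⟩ := hf x (hgs hx)
    refine ⟨?_, fun v => ?_⟩
    · have := hrad _ u hu 1 (by simp)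
      rwa [hu1, one_smul, add_sub_cancel] at this
    · rw [hgcoe, hxd.fderiv]
      exact apply_coframeMap (q := (x, f x)) (hinv _ hxW.2) v

end

/-! ### Vector fields in charts -/

theorem two_le_infty : (2 : WithTop ℕ∞) ≤ ∞ := by
  exact WithTop.coe_le_coe.2 (le_top : (2 : ℕ∞) ≤ ⊤)

section
variable {n : ℕ} {M : Type*} [TopologicalSpace M] [ChartedSpace (EuclideanSpace ℝ (Fin n)) M]
  {e : OpenPartialHomeomorph M (EuclideanSpace ℝ (Fin n))}

theorem mdifferentiable_of_mem_maximalAtlas (he : e ∈ IsManifold.maximalAtlas (𝓡 n) ∞ M) :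
    e.MDifferentiable (𝓡 n) (𝓡 n) :=
  ⟨(contMDiffOn_of_mem_maximalAtlas he).mdifferentiableOn (by simp),
    (contMDiffOn_symm_of_mem_maximalAtlas he).mdifferentiableOn (by simp)⟩

/-- The expression of a vector field in a chart. -/
def chartField (e : OpenPartialHomeomorph M (EuclideanSpace ℝ (Fin n)))
    (V : ∀ q : M, TangentSpace (𝓡 n) q) (y : EuclideanSpace ℝ (Fin n)) :
    EuclideanSpace ℝ (Fin n) :=
  mfderiv (𝓡 n) (𝓡 n) e (e.symm y) (V (e.symm y))

theorem inverse_mfderiv_symm (he : e ∈ IsManifold.maximalAtlas (𝓡 n) ∞ M)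
    {y : EuclideanSpace ℝ (Fin n)} (hy : y ∈ e.target) :
    (mfderiv (𝓡 n) (𝓡 n) e.symm y).inverse = mfderiv (𝓡 n) (𝓡 n) e (e.symm y) := by
  have hm := mdifferentiable_of_mem_maximalAtlas he
  exact ContinuousLinearMap.inverse_eq (hm.symm_comp_deriv (e.map_target hy) |> fun h => by
    rwa [e.right_inv hy] at h) (hm.comp_symm_deriv hy)

theorem isInvertible_mfderiv_symm (he : e ∈ IsManifold.maximalAtlas (𝓡 n) ∞ M)
    {y : EuclideanSpace ℝ (Fin n)} (hy : y ∈ e.target) :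
    (mfderiv (𝓡 n) (𝓡 n) e.symm y).IsInvertible :=
  ⟨(mdifferentiable_of_mem_maximalAtlas he).symm.mfderiv (e := e.symm) hy, rfl⟩

theorem chartField_eq_mpullback (he : e ∈ IsManifold.maximalAtlas (𝓡 n) ∞ M)
    (V : ∀ q : M, TangentSpace (𝓡 n) q) :
    ∀ y ∈ e.target, VectorField.mpullback (𝓡 n) (𝓡 n) e.symm V y = chartField e V y := by
  intro y hy
  rw [VectorField.mpullback_apply, inverse_mfderiv_symm he hy]
  rfl

variable [IsManifold (𝓡 n) ∞ M]

theorem contDiffOn_chartField (he : e ∈ IsManifold.maximalAtlas (𝓡 n) ∞ M)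
    {V : ∀ q : M, TangentSpace (𝓡 n) q} (hV : SmoothField V) :
    ContDiffOn ℝ ∞ (chartField e V) e.target := by
  intro y hy
  have h1 := ContMDiffAt.mpullback_vectorField_preimage (I := 𝓡 n) (I' := 𝓡 n) (f := e.symm)
    (x₀ := y) (m := ∞) (n := ∞) (V := V) (hV.contMDiffAt)
    (contMDiffAt_symm_of_mem_maximalAtlas he hy) (isInvertible_mfderiv_symm he hy) (by simp)
  rw [contMDiffAt_vectorSpace_iff_contDiffAt] at h1
  refine (h1.congr_of_eventuallyEq ?_).contDiffWithinAt
  filter_upwards [e.open_target.mem_nhds hy] with z hz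
  exact (chartField_eq_mpullback he V z hz).symm

/-- The bracket is natural under pullback by `e.symm`, and `chartField e` is that pullback on the
target of `e`. -/
theorem mfderiv_mlieBracket (he : e ∈ IsManifold.maximalAtlas (𝓡 n) ∞ M)
    {V W : ∀ q : M, TangentSpace (𝓡 n) q} (hV : SmoothField V) (hW : SmoothField W)
    {q : M} (hq : q ∈ e.source) :
    mfderiv (𝓡 n) (𝓡 n) e q (VectorField.mlieBracket (𝓡 n) V W q) =
      VectorField.lieBracket ℝ (chartField e V) (chartField e W) (e q) := by
  have hy := e.map_source hq
  have : IsManifold (𝓡 n) (minSmoothness ℝ 2) M :=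
    .of_le (n := ∞) (by rw [minSmoothness_of_isRCLikeNormedField]; exact two_le_infty)
  have h1 := VectorField.mpullback_mlieBracket (I := 𝓡 n) (I' := 𝓡 n) (f := e.symm)
    (x₀ := e q) (n := ∞) (V := V) (W := W) (hV.mdifferentiable (by simp) _)
    (hW.mdifferentiable (by simp) _)
    (contMDiffAt_symm_of_mem_maximalAtlas he hy)
    (by rw [minSmoothness_of_isRCLikeNormedField]; exact two_le_infty)
  rw [chartField_eq_mpullback he _ _ hy] at h1
  have h2 : chartField e (VectorField.mlieBracket (𝓡 n) V W) (e q) =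
      mfderiv (𝓡 n) (𝓡 n) e q (VectorField.mlieBracket (𝓡 n) V W q) := by
    unfold chartField
    rw [e.left_inv hq]
  rw [h2] at h1
  rw [h1, ← VectorField.mlieBracketWithin_univ, VectorField.mlieBracketWithin_eq_lieBracketWithin]
  have hev : ∀ V : (∀ q : M, TangentSpace (𝓡 n) q),
      VectorField.mpullback (𝓡 n) (𝓡 n) e.symm V =ᶠ[𝓝 (e q)] chartField e V := fun V => by
    filter_upwards [e.open_target.mem_nhds hy] with z hz
    exact chartField_eq_mpullback he V z hz
  refine Eq.trans (congrFun (VectorField.lieBracketWithin_univ (𝕜 := ℝ)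
    (E := EuclideanSpace ℝ (Fin n))) _) ?_
  exact Filter.EventuallyEq.lieBracket_vectorField_eq (E := EuclideanSpace ℝ (Fin n)) (hev V) (hev W)

/-- There is a smooth vector field with a given constant expression near a point of a chart. -/
theorem exists_smoothField_eq (he : e ∈ IsManifold.maximalAtlas (𝓡 n) ∞ M) [T2Space M] {q : M}
    (hq : q ∈ e.source) (v : EuclideanSpace ℝ (Fin n)) :
    ∃ V : ∀ q : M, TangentSpace (𝓡 n) q, SmoothField V ∧
      ∀ᶠ y in 𝓝 (e q), chartField e V y = v := by
  have hm := mdifferentiable_of_mem_maximalAtlas he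
  obtain ⟨ψ, -, hψ⟩ := (SmoothBumpFunction.nhds_basis_tsupport (I := 𝓡 n) q).mem_iff.1
    (e.open_source.mem_nhds hq)
  set V₀ : ∀ q : M, TangentSpace (𝓡 n) q :=
    VectorField.mpullback (𝓡 n) (𝓡 n) e (fun _ => v) with hV₀
  have hinv : ∀ p ∈ e.source, (mfderiv (𝓡 n) (𝓡 n) e p).IsInvertible := fun p hp =>
    ⟨hm.mfderiv hp, rfl⟩
  refine ⟨fun p => ψ p • V₀ p, ?_, ?_⟩
  · refine ContMDiffOn.smul_section_of_tsupport (u := e.source) ψ.contMDiff.contMDiffOn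
      e.open_source hψ fun p hp => ContMDiffAt.contMDiffWithinAt ?_
    refine ContMDiffAt.mpullback_vectorField_preimage (I := 𝓡 n) (I' := 𝓡 n) (f := e)
      (x₀ := p) (m := ∞) (n := ∞) (V := fun _ => v) ?_
      (contMDiffAt_of_mem_maximalAtlas he hp) (hinv p hp) (by simp)
    exact (contMDiffAt_vectorSpace_iff_contDiffAt (V := fun _ => v)).2 contDiffAt_const
  · have h1 : ∀ᶠ y in 𝓝 (e q), ψ (e.symm y) = 1 := by
      have := (e.continuousAt_symm (e.map_source hq)).tendsto
      rw [e.left_inv hq] at this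
      exact this.eventually ψ.eventuallyEq_one
    filter_upwards [h1, e.open_target.mem_nhds (e.map_source hq)] with y hy hyt
    obtain ⟨e', he'⟩ := hinv _ (e.map_target hyt)
    simp only [chartField, hy, one_smul]
    change mfderiv (𝓡 n) (𝓡 n) e (e.symm y)
      ((mfderiv (𝓡 n) (𝓡 n) e (e.symm y)).inverse v) = v
    rw [← he', ContinuousLinearMap.inverse_equiv]
    exact e'.apply_symm_apply v

end

/-! ### Velocities of curves and uniqueness of `A`-paths -/

/-- Local uniqueness of solutions of an ODE on a closed interval, near any of its points. -/
theorem eventuallyEq_of_hasDerivWithinAt_Icc {E : Type*} [NormedAddCommGroup E] [NormedSpace ℝ E]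
    {v : ℝ → E → E} {a b t₀ : ℝ} {K : NNReal} {U : Set E} {f g : ℝ → E}
    (ht₀ : t₀ ∈ Icc a b) (hv : ∀ t ∈ Icc a b, LipschitzOnWith K (v t) U) (hU : U ∈ 𝓝 (f t₀))
    (hf : ∀ᶠ t in 𝓝[Icc a b] t₀, HasDerivWithinAt f (v t (f t)) (Icc a b) t)
    (hg : ∀ᶠ t in 𝓝[Icc a b] t₀, HasDerivWithinAt g (v t (g t)) (Icc a b) t)
    (h0 : f t₀ = g t₀) : f =ᶠ[𝓝[Icc a b] t₀] g := by
  have hfU : ∀ᶠ t in 𝓝[Icc a b] t₀, f t ∈ U :=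
    (hf.self_of_nhdsWithin ht₀).continuousWithinAt.eventually_mem hU
  have hgU : ∀ᶠ t in 𝓝[Icc a b] t₀, g t ∈ U :=
    (hg.self_of_nhdsWithin ht₀).continuousWithinAt.eventually_mem (h0 ▸ hU)
  obtain ⟨ε, hε, H⟩ := Metric.mem_nhdsWithin_iff.1 ((hf.and hg).and (hfU.and hgU))
  refine Metric.mem_nhdsWithin_iff.2 ⟨ε / 2, by positivity, ?_⟩
  rintro t ⟨ht, htI⟩
  have hsub : ∀ s ∈ uIcc t t₀, s ∈ Icc a b ∧ ((HasDerivWithinAt f (v s (f s)) (Icc a b) s ∧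
      HasDerivWithinAt g (v s (g s)) (Icc a b) s) ∧ f s ∈ U ∧ g s ∈ U) := by
    intro s hs
    have hsI : s ∈ Icc a b := ordConnected_Icc.uIcc_subset htI ht₀ hs
    refine ⟨hsI, H ⟨?_, hsI⟩⟩
    rw [mem_ball, Real.dist_eq] at ht ⊢
    have := abs_sub_right_of_mem_uIcc hs
    rw [abs_sub_comm t₀ s, abs_sub_comm t₀ t] at this
    linarith
  rcases le_total t t₀ with h | h
  · rw [uIcc_of_le h] at hsub
    have hc : Icc t t₀ ⊆ Icc a b := fun s hs => (hsub s hs).1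
    refine ODE_solution_unique_of_mem_Icc_left (v := v) (s := fun _ => U) (K := K)
      (fun s hs => hv s (hsub s (Ioc_subset_Icc_self hs)).1)
      (fun s hs => (hsub s hs).2.1.1.continuousWithinAt.mono hc)
      (fun s hs => ?_) (fun s hs => (hsub s (Ioc_subset_Icc_self hs)).2.2.1)
      (fun s hs => (hsub s hs).2.1.2.continuousWithinAt.mono hc)
      (fun s hs => ?_) (fun s hs => (hsub s (Ioc_subset_Icc_self hs)).2.2.2) h0 ⟨le_rfl, h⟩
    · exact HasDerivWithinAt.Iic_of_Icc ((hsub s (Ioc_subset_Icc_self hs)).2.1.1)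
        ⟨htI.1.trans_lt hs.1, hs.2.trans ht₀.2⟩
    · exact HasDerivWithinAt.Iic_of_Icc ((hsub s (Ioc_subset_Icc_self hs)).2.1.2)
        ⟨htI.1.trans_lt hs.1, hs.2.trans ht₀.2⟩
  · rw [uIcc_of_ge h] at hsub
    have hc : Icc t₀ t ⊆ Icc a b := fun s hs => (hsub s hs).1
    refine ODE_solution_unique_of_mem_Icc_right (v := v) (s := fun _ => U) (K := K)
      (fun s hs => hv s (hsub s (Ico_subset_Icc_self hs)).1)
      (fun s hs => (hsub s hs).2.1.1.continuousWithinAt.mono hc)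
      (fun s hs => ?_) (fun s hs => (hsub s (Ico_subset_Icc_self hs)).2.2.1)
      (fun s hs => (hsub s hs).2.1.2.continuousWithinAt.mono hc)
      (fun s hs => ?_) (fun s hs => (hsub s (Ico_subset_Icc_self hs)).2.2.2) h0 ⟨h, le_rfl⟩
    · exact HasDerivWithinAt.Ici_of_Icc ((hsub s (Ico_subset_Icc_self hs)).2.1.1)
        ⟨ht₀.1.trans hs.1, hs.2.trans_le htI.2⟩
    · exact HasDerivWithinAt.Ici_of_Icc ((hsub s (Ico_subset_Icc_self hs)).2.1.2)
        ⟨ht₀.1.trans hs.1, hs.2.trans_le htI.2⟩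

theorem comp_smulRight_one {V W : Type*} [AddCommGroup V] [Module ℝ V] [TopologicalSpace V]
    [ContinuousSMul ℝ V] [AddCommGroup W] [Module ℝ W] [TopologicalSpace W] [ContinuousSMul ℝ W]
    (A : V →L[ℝ] W) (v : V) :
    A ∘L (1 : ℝ →L[ℝ] ℝ).smulRight v = (1 : ℝ →L[ℝ] ℝ).smulRight (A v) :=
  ContinuousLinearMap.ext_ring (by
    change A ((1 : ℝ) • v) = (1 : ℝ) • A v
    rw [one_smul, one_smul])

section
variable {n : ℕ} {M : Type*} [TopologicalSpace M] [ChartedSpace (EuclideanSpace ℝ (Fin n)) M]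
  {e : OpenPartialHomeomorph M (EuclideanSpace ℝ (Fin n))}

/-- `γ` has velocity `v` at `t` within `s`. -/
def HasVelocityWithinAt (γ : ℝ → M) (s : Set ℝ) (t : ℝ) (v : TangentSpace (𝓡 n) (γ t)) : Prop :=
  HasMFDerivWithinAt 𝓘(ℝ, ℝ) (𝓡 n) γ s t ((1 : ℝ →L[ℝ] ℝ).smulRight v)

theorem HasVelocityWithinAt.hasDerivWithinAt_chart
    (he : e ∈ IsManifold.maximalAtlas (𝓡 n) ∞ M) {γ : ℝ → M} {s : Set ℝ} {t : ℝ}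
    {v : TangentSpace (𝓡 n) (γ t)} (hγ : HasVelocityWithinAt γ s t v) (ht : γ t ∈ e.source) :
    HasDerivWithinAt (e ∘ γ) (mfderiv (𝓡 n) (𝓡 n) e (γ t) v : EuclideanSpace ℝ (Fin n)) s t := by
  have h1 := ((mdifferentiable_of_mem_maximalAtlas he).mdifferentiableAt ht).hasMFDerivAt
  have h2 := h1.comp_hasMFDerivWithinAt t hγ
  have h3 := h2.congr_mfderiv (comp_smulRight_one _ v)
  set w : EuclideanSpace ℝ (Fin n) := mfderiv (𝓡 n) (𝓡 n) e (γ t) v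
  have h4 : HasFDerivWithinAt (e ∘ γ) ((1 : ℝ →L[ℝ] ℝ).smulRight w) s t :=
    hasMFDerivWithinAt_iff_hasFDerivWithinAt.1 h3
  exact h4.hasDerivWithinAt.congr_deriv (by simp)

theorem HasVelocityWithinAt.of_chart (he : e ∈ IsManifold.maximalAtlas (𝓡 n) ∞ M)
    {c : ℝ → EuclideanSpace ℝ (Fin n)} {s : Set ℝ} {t : ℝ} {v : EuclideanSpace ℝ (Fin n)}
    (hc : HasDerivWithinAt c v s t) (ht : c t ∈ e.target) :
    HasVelocityWithinAt (e.symm ∘ c) s t (mfderiv (𝓡 n) (𝓡 n) e.symm (c t) v) := by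
  have h1 := ((mdifferentiable_of_mem_maximalAtlas he).mdifferentiableAt_symm ht).hasMFDerivAt
  have h3 : HasFDerivWithinAt c ((1 : ℝ →L[ℝ] ℝ).smulRight v) s t :=
    hc.hasFDerivWithinAt.congr_fderiv (by ext; simp)
  have h2 := h1.comp_hasMFDerivWithinAt t (hasMFDerivWithinAt_iff_hasFDerivWithinAt.2 h3)
  exact h2.congr_mfderiv (comp_smulRight_one _ v)

theorem HasVelocityWithinAt.map {d : ℕ} {X : Type*} [TopologicalSpace X]
    [ChartedSpace (EuclideanSpace ℝ (Fin d)) X] {h : M → X} {γ : ℝ → M} {s : Set ℝ} {t : ℝ}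
    {v : TangentSpace (𝓡 n) (γ t)} (hγ : HasVelocityWithinAt γ s t v)
    (hh : MDifferentiableAt (𝓡 n) (𝓡 d) h (γ t)) :
    HasVelocityWithinAt (h ∘ γ) s t (mfderiv (𝓡 n) (𝓡 d) h (γ t) v) := by
  have h2 := hh.hasMFDerivAt.comp_hasMFDerivWithinAt t hγ
  exact h2.congr_mfderiv (comp_smulRight_one _ v)

theorem HasVelocityWithinAt.continuousWithinAt {γ : ℝ → M} {s : Set ℝ} {t : ℝ}
    {v : TangentSpace (𝓡 n) (γ t)} (hγ : HasVelocityWithinAt γ s t v) :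
    ContinuousWithinAt γ s t := HasMFDerivWithinAt.continuousWithinAt hγ

end

namespace Data
variable {n d : ℕ} {X : Type u} [TopologicalSpace X]
  [ChartedSpace (EuclideanSpace ℝ (Fin d)) X] [IsManifold (𝓡 d) ∞ X] (D : Data n d X)

/-- `γ` is the base path of an `A`-path with coefficients `a` over the interval `[α, β]`. -/
def IsAnchored (γ : ℝ → X) (a : ℝ → Fin n → ℝ) (α β : ℝ) : Prop :=
  ∀ t ∈ Icc α β, HasVelocityWithinAt γ (Icc α β) t (D.anchor (γ t) (a t))

/-- The anchor in a chart. -/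
theorem mfderiv_anchor (e : OpenPartialHomeomorph X (EuclideanSpace ℝ (Fin d))) (x : X)
    (a : Fin n → ℝ) (hx : x ∈ e.source) :
    (mfderiv (𝓡 d) (𝓡 d) e x (D.anchor x a) : EuclideanSpace ℝ (Fin d)) =
      ∑ i, a i • chartField e (D.F i) (e x) := by
  unfold anchor
  rw [map_sum]
  refine Finset.sum_congr rfl fun i _ => ?_
  rw [map_smul]
  unfold chartField
  rw [e.left_inv hx]
  rfl

variable {D}

/-- In a chart the base path solves `y' = ∑ a_i(t) F_i(y)`. The fields are locally Lipschitz and `a`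
is bounded on the compact interval, so the equation is Lipschitz near the point uniformly in `t`. -/
theorem IsAnchored.eventuallyEq {γ γ' : ℝ → X} {a : ℝ → Fin n → ℝ} {α β t₀ : ℝ}
    (ha : ContinuousOn a (Icc α β)) (h : D.IsAnchored γ a α β) (h' : D.IsAnchored γ' a α β)
    (ht₀ : t₀ ∈ Icc α β) (h0 : γ t₀ = γ' t₀) : γ =ᶠ[𝓝[Icc α β] t₀] γ' := by
  set e := chartAt (EuclideanSpace ℝ (Fin d)) (γ t₀) with hedef
  have he : e ∈ IsManifold.maximalAtlas (𝓡 d) ∞ X := IsManifold.chart_mem_maximalAtlas _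
  have hs : γ t₀ ∈ e.source := mem_chart_source _ _
  have hF : ∀ i, ∃ K : NNReal, ∃ U ∈ 𝓝 (e (γ t₀)), LipschitzOnWith K (chartField e (D.F i)) U := by
    intro i
    have h1 : ContDiffAt ℝ 1 (chartField e (D.F i)) (e (γ t₀)) :=
      (((contDiffOn_chartField he (D.smooth_F i)).contDiffAt
        (e.open_target.mem_nhds (e.map_source hs)))).of_le (by exact_mod_cast le_top)
    exact h1.exists_lipschitzOnWith
  choose K U hU hK using hF
  obtain ⟨B, hB⟩ := isCompact_Icc.exists_bound_of_continuousOn ha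
  have hlip : ∀ t ∈ Icc α β, LipschitzOnWith (∑ i, B.toNNReal * K i)
      (fun y => ∑ i, a t i • chartField e (D.F i) y) (⋂ i, U i) := by
    intro t ht
    refine LipschitzOnWith.of_dist_le_mul fun y hy z hz => ?_
    rw [dist_eq_norm, ← Finset.sum_sub_distrib, NNReal.coe_sum, Finset.sum_mul]
    refine (norm_sum_le _ _).trans (Finset.sum_le_sum fun i _ => ?_)
    rw [← smul_sub, norm_smul, NNReal.coe_mul, mul_assoc]
    refine mul_le_mul (((norm_le_pi_norm (a t) i).trans (hB t ht)).trans (Real.le_coe_toNNReal B))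
      ?_ (norm_nonneg _) (NNReal.coe_nonneg _)
    rw [← dist_eq_norm]
    exact (hK i).dist_le_mul y (mem_iInter.1 hy i) z (mem_iInter.1 hz i)
  have hev : ∀ {c : ℝ → X}, D.IsAnchored c a α β → c t₀ ∈ e.source →
      (∀ᶠ t in 𝓝[Icc α β] t₀, c t ∈ e.source) ∧ ∀ᶠ t in 𝓝[Icc α β] t₀,
        HasDerivWithinAt (e ∘ c) (∑ i, a t i • chartField e (D.F i) ((e ∘ c) t)) (Icc α β) t := by
    intro c hc hcs
    have h1 : ∀ᶠ t in 𝓝[Icc α β] t₀, c t ∈ e.source :=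
      (hc t₀ ht₀).continuousWithinAt.eventually_mem (e.open_source.mem_nhds hcs)
    refine ⟨h1, ?_⟩
    filter_upwards [h1, self_mem_nhdsWithin] with t ht htI
    have := (hc t htI).hasDerivWithinAt_chart he ht
    rwa [mfderiv_anchor D e _ _ ht] at this
  obtain ⟨h1, h2⟩ := hev h hs
  obtain ⟨h1', h2'⟩ := hev h' (h0 ▸ hs)
  have := eventuallyEq_of_hasDerivWithinAt_Icc (f := e ∘ γ) (g := e ∘ γ') ht₀ hlip
    (Filter.iInter_mem.2 hU) h2 h2' (by simp [h0])
  filter_upwards [this, h1, h1'] with t ht hts hts'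
  exact e.injOn hts hts' ht

/-- The coincidence set is closed because `X` is Hausdorff, and local uniqueness lets it extend to
the right of each of its points. -/
theorem IsAnchored.eqOn [T2Space X] {γ γ' : ℝ → X} {a : ℝ → Fin n → ℝ} {α β : ℝ}
    (ha : ContinuousOn a (Icc α β)) (h : D.IsAnchored γ a α β) (h' : D.IsAnchored γ' a α β)
    (h0 : γ α = γ' α) : EqOn γ γ' (Icc α β) := by
  have hc : ContinuousOn γ (Icc α β) := fun t ht => (h t ht).continuousWithinAt
  have hc' : ContinuousOn γ' (Icc α β) := fun t ht => (h' t ht).continuousWithinAt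
  have hclosed : IsClosed ({t | γ t = γ' t} ∩ Icc α β) := by
    have : IsClosed (Icc α β ∩ (fun t => (γ t, γ' t)) ⁻¹' diagonal X) :=
      (hc.prodMk hc').preimage_isClosed_of_isClosed isClosed_Icc isClosed_diagonal
    rwa [inter_comm] at this
  intro t ht
  refine hclosed.Icc_subset_of_forall_mem_nhdsWithin h0 (fun s hs => ?_) ht
  have hs' := IsAnchored.eventuallyEq ha h h' (Ico_subset_Icc_self hs.2) hs.1
  have : 𝓝[>] s ≤ 𝓝[Icc α β] s := by
    rw [← nhdsWithin_Ioc_eq_nhdsGT hs.2.2]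
    exact nhdsWithin_mono _ fun r hr => ⟨hs.2.1.trans hr.1.le, hr.2⟩
  exact this hs'

end Data

/-! ### The structure equations in a chart -/

section
variable {n : ℕ} {M : Type*} [TopologicalSpace M] [ChartedSpace (EuclideanSpace ℝ (Fin n)) M]
  {e : OpenPartialHomeomorph M (EuclideanSpace ℝ (Fin n))}

theorem mvfderiv_eq_fderiv_chart (he : e ∈ IsManifold.maximalAtlas (𝓡 n) ∞ M) {q : M}
    (hq : q ∈ e.source) {f : M → ℝ} {g : EuclideanSpace ℝ (Fin n) → ℝ}
    {g' : EuclideanSpace ℝ (Fin n) →L[ℝ] ℝ} (hfg : f =ᶠ[𝓝 q] g ∘ e)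
    (hg : HasFDerivAt g g' (e q)) (v : TangentSpace (𝓡 n) q) :
    mvfderiv (𝓡 n) f q v = g' (mfderiv (𝓡 n) (𝓡 n) e q v) := by
  have h1 := ((mdifferentiable_of_mem_maximalAtlas he).mdifferentiableAt hq).hasMFDerivAt
  have h2 : HasMFDerivAt (𝓡 n) 𝓘(ℝ, ℝ) f q (g'.comp (mfderiv (𝓡 n) (𝓡 n) e q)) :=
    (HasMFDerivAt.comp q hg.hasMFDerivAt h1).congr_of_eventuallyEq hfg
  unfold mvfderiv
  rw [h2.mfderiv]
  rfl

/-- A family of covectors `θ` is given in the chart `e` by `ϑ`. -/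
def IsChartForm {F : Type*} [NormedAddCommGroup F] [NormedSpace ℝ F]
    (e : OpenPartialHomeomorph M (EuclideanSpace ℝ (Fin n)))
    (θ : ∀ p : M, TangentSpace (𝓡 n) p →L[ℝ] F)
    (ϑ : EuclideanSpace ℝ (Fin n) → EuclideanSpace ℝ (Fin n) →L[ℝ] F) : Prop :=
  ∀ q ∈ e.source, ∀ v, θ q v = ϑ (e q) (mfderiv (𝓡 n) (𝓡 n) e q v)

/-- The expression in a chart of `V(θ(W)) - W(θ(V)) - θ([V, W])`. -/
theorem exteriorDerivative_eq_chart [IsManifold (𝓡 n) ∞ M]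
    (he : e ∈ IsManifold.maximalAtlas (𝓡 n) ∞ M)
    {θ : ∀ p : M, TangentSpace (𝓡 n) p →L[ℝ] (Fin n → ℝ)}
    {ϑ : EuclideanSpace ℝ (Fin n) → EuclideanSpace ℝ (Fin n) →L[ℝ] (Fin n → ℝ)}
    (hθ : IsChartForm e θ ϑ) {q : M} (hq : q ∈ e.source) (hd : DifferentiableAt ℝ ϑ (e q))
    {V W : ∀ p : M, TangentSpace (𝓡 n) p} (hV : SmoothField V) (hW : SmoothField W) (k : Fin n) :
    mvfderiv (𝓡 n) (fun p => θ p (W p) k) q (V q)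
        - mvfderiv (𝓡 n) (fun p => θ p (V p) k) q (W q)
        - θ q (VectorField.mlieBracket (𝓡 n) V W q) k =
      fderiv ℝ ϑ (e q) (chartField e V (e q)) (chartField e W (e q)) k -
        fderiv ℝ ϑ (e q) (chartField e W (e q)) (chartField e V (e q)) k := by
  have hcf : ∀ (Z : ∀ p : M, TangentSpace (𝓡 n) p), ∀ p ∈ e.source,
      chartField e Z (e p) = mfderiv (𝓡 n) (𝓡 n) e p (Z p) := fun Z p hp => by
    unfold chartField
    rw [e.left_inv hp]
  have hdf : ∀ Z : (∀ p : M, TangentSpace (𝓡 n) p), SmoothField Z →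
      HasFDerivAt (chartField e Z) (fderiv ℝ (chartField e Z) (e q)) (e q) := fun Z hZ =>
    (((contDiffOn_chartField he hZ).contDiffAt (e.open_target.mem_nhds
      (e.map_source hq))).differentiableAt (by simp)).hasFDerivAt
  -- The product rule for `ϑ y (Z y)`. The terms differentiating the fields cancel against the
  -- bracket, so the final expression depends only on the values of `V` and `W` at the point.
  have key : ∀ Z Y : (∀ p : M, TangentSpace (𝓡 n) p), SmoothField Z →
      mvfderiv (𝓡 n) (fun p => θ p (Z p) k) q (Y q) =
        (fderiv ℝ ϑ (e q) (chartField e Y (e q)) (chartField e Z (e q)) +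
          ϑ (e q) (fderiv ℝ (chartField e Z) (e q) (chartField e Y (e q)))) k := by
    intro Z Y hZ
    have h1 := hd.hasFDerivAt.clm_apply (hdf Z hZ)
    have h2 : HasFDerivAt (fun y => ϑ y (chartField e Z y) k) _ (e q) :=
      (ContinuousLinearMap.proj (R := ℝ) (φ := fun _ : Fin n => ℝ) k).hasFDerivAt.comp (e q) h1
    rw [mvfderiv_eq_fderiv_chart he hq ?_ h2, ← hcf Y q hq]
    · simp [add_comm]
    · filter_upwards [e.open_source.mem_nhds hq] with p hp
      rw [hθ p hp, ← hcf Z p hp]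
      rfl
  rw [key W V hW, key V W hV, hθ q hq, mfderiv_mlieBracket he hV hW hq, VectorField.lieBracket,
    map_sub]
  simp only [Pi.add_apply, Pi.sub_apply]
  ring

end

/-- The quadratic expression `∑_{i<j} C_{ij}^k (a^i b^j - b^i a^j)`. -/
def structureForm {n : ℕ} (C : Fin n → Fin n → Fin n → ℝ) (a b : Fin n → ℝ) : Fin n → ℝ :=
  fun k => ∑ i, ∑ j, if i < j then C i j k * (a i * b j - b i * a j) else 0

namespace Data
variable {n d : ℕ} {X : Type u} [TopologicalSpace X]
  [ChartedSpace (EuclideanSpace ℝ (Fin d)) X] [IsManifold (𝓡 d) ∞ X] {D : Data n d X}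

namespace Realization
variable {M : Type v} [TopologicalSpace M]
    [ChartedSpace (EuclideanSpace ℝ (Fin n)) M] [IsManifold (𝓡 n) ∞ M] (R : D.Realization M)
  {e : OpenPartialHomeomorph M (EuclideanSpace ℝ (Fin n))}

/-- The coframe of a realization in a chart. -/
def chartForm (e : OpenPartialHomeomorph M (EuclideanSpace ℝ (Fin n)))
    (y : EuclideanSpace ℝ (Fin n)) : EuclideanSpace ℝ (Fin n) →L[ℝ] (Fin n → ℝ) :=
  (R.θ (e.symm y)).comp (mfderiv (𝓡 n) (𝓡 n) e.symm y)

theorem isChartForm_chartForm (he : e ∈ IsManifold.maximalAtlas (𝓡 n) ∞ M) :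
    IsChartForm e R.θ (R.chartForm e) := by
  intro q hq v
  have h := DFunLike.congr_fun ((mdifferentiable_of_mem_maximalAtlas he).symm_comp_deriv hq) v
  change R.θ q v = R.θ (e.symm (e q)) (mfderiv (𝓡 n) (𝓡 n) e.symm (e q)
    (mfderiv (𝓡 n) (𝓡 n) e q v))
  change mfderiv (𝓡 n) (𝓡 n) e.symm (e q) (mfderiv (𝓡 n) (𝓡 n) e q v) = v at h
  rw [h, e.left_inv hq]

theorem isInvertible_chartForm (he : e ∈ IsManifold.maximalAtlas (𝓡 n) ∞ M)
    {y : EuclideanSpace ℝ (Fin n)} (hy : y ∈ e.target) : (R.chartForm e y).IsInvertible := by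
  have hb : Function.Bijective (R.chartForm e y) :=
    (R.coframe (e.symm y)).comp
      ((mdifferentiable_of_mem_maximalAtlas he).symm.mfderiv_bijective (e := e.symm) hy)
  exact ⟨(LinearEquiv.ofBijective (R.chartForm e y).toLinearMap hb).toContinuousLinearEquiv,
    by ext; rfl⟩

/-- Smoothness into linear maps is tested on constant vectors `v`: the tangent map of `e.symm` sends
the constant field `v` to a smooth map into `TM`, on which `θ` is smooth. -/
theorem contDiffOn_chartForm (he : e ∈ IsManifold.maximalAtlas (𝓡 n) ∞ M) :
    ContDiffOn ℝ ∞ (R.chartForm e) e.target := by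
  rw [contDiffOn_clm_apply]
  intro v
  have h1 : ContMDiffOn (𝓡 n).tangent (𝓡 n).tangent ∞
      (tangentMapWithin (𝓡 n) (𝓡 n) e.symm e.target) (Bundle.TotalSpace.proj ⁻¹' e.target) :=
    (contMDiffOn_symm_of_mem_maximalAtlas he).contMDiffOn_tangentMapWithin (by simp)
      e.open_target.uniqueMDiffOn
  have h2 : ContMDiffOn (𝓡 n) (𝓡 n).tangent ∞ (fun y : EuclideanSpace ℝ (Fin n) =>
      (⟨y, v⟩ : TangentBundle (𝓡 n) (EuclideanSpace ℝ (Fin n)))) e.target :=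
    (contMDiffOn_vectorSpace_iff_contDiffOn (V := fun _ => v)).2 contDiffOn_const
  have h3 := R.smooth_θ.comp_contMDiffOn (h1.comp h2 fun y hy => hy)
  refine (contMDiffOn_iff_contDiffOn.1 h3).congr fun y hy => ?_
  change R.θ (e.symm y) (mfderiv (𝓡 n) (𝓡 n) e.symm y v) =
    R.θ (e.symm y) (mfderivWithin (𝓡 n) (𝓡 n) e.symm e.target y v)
  rw [mfderivWithin_of_isOpen e.open_target hy]

/-- The structure equation speaks of global vector fields. Bump functions extend any two tangent
vectors to such fields, and by tensoriality (`exteriorDerivative_eq_chart`) the choice of extension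
does not matter. -/
theorem curlEq_chartForm [T2Space M] (he : e ∈ IsManifold.maximalAtlas (𝓡 n) ∞ M)
    {y : EuclideanSpace ℝ (Fin n)} (hy : y ∈ e.target) :
    CurlEq (R.chartForm e) (structureForm fun i j k => D.C i j k (R.h (e.symm y))) y := by
  intro v w
  set q := e.symm y with hqdef
  have hq : q ∈ e.source := e.map_target hy
  have hyq : e q = y := e.right_inv hy
  obtain ⟨V, hV, hVv⟩ := exists_smoothField_eq he hq v
  obtain ⟨W, hW, hWw⟩ := exists_smoothField_eq he hq w
  have hd : DifferentiableAt ℝ (R.chartForm e) (e q) :=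
    ((R.contDiffOn_chartForm he).contDiffAt (e.open_target.mem_nhds
      (e.map_source hq))).differentiableAt (by simp)
  have hv : chartField e V (e q) = v := hVv.self_of_nhds
  have hw : chartField e W (e q) = w := hWw.self_of_nhds
  have hθ : ∀ Z : (∀ p : M, TangentSpace (𝓡 n) p), R.θ q (Z q) =
      R.chartForm e (e q) (chartField e Z (e q)) := fun Z => by
    rw [R.isChartForm_chartForm he q hq]
    unfold chartField
    rw [e.left_inv hq]
  ext k
  have h1 := exteriorDerivative_eq_chart he (R.isChartForm_chartForm he) hq hd hV hW k
  rw [R.structure_eq V W hV hW k q, hθ V, hθ W, hv, hw, hyq] at h1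
  exact h1.symm

end Realization
end Data

/-! ### Local uniqueness of realizations -/

namespace Data
variable {n d : ℕ} {X : Type u} [TopologicalSpace X]
  [ChartedSpace (EuclideanSpace ℝ (Fin d)) X] [IsManifold (𝓡 d) ∞ X] {D : Data n d X}

namespace Realization
variable {M : Type v} [TopologicalSpace M]
    [ChartedSpace (EuclideanSpace ℝ (Fin n)) M] [IsManifold (𝓡 n) ∞ M] (R : D.Realization M)
  {e : OpenPartialHomeomorph M (EuclideanSpace ℝ (Fin n))}

/-- The image under `h` of a curve given in a chart is anchored. -/
theorem hasVelocityWithinAt_h_symm (he : e ∈ IsManifold.maximalAtlas (𝓡 n) ∞ M)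
    {c : ℝ → EuclideanSpace ℝ (Fin n)} {s : Set ℝ} {t : ℝ} {c' : EuclideanSpace ℝ (Fin n)}
    (hc : HasDerivWithinAt c c' s t) (ht : c t ∈ e.target) :
    HasVelocityWithinAt (fun t => R.h (e.symm (c t))) s t
      (D.anchor (R.h (e.symm (c t))) (R.chartForm e (c t) c')) := by
  have h1 := (HasVelocityWithinAt.of_chart he hc ht).map
    (R.smooth_h.mdifferentiable (by simp) (e.symm (c t)))
  have h2 := R.dh_eq (e.symm (c t)) (mfderiv (𝓡 n) (𝓡 n) e.symm (c t) c')
  unfold HasVelocityWithinAt at h1 ⊢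
  exact h1.congr_mfderiv (congrArg _ h2)

/-- Local uniqueness: realizations with the same value of `h` have the same germ. -/
theorem sameGerm_of_h_eq [T2Space X] {M₀ : Type w} [TopologicalSpace M₀]
    [ChartedSpace (EuclideanSpace ℝ (Fin n)) M₀] [IsManifold (𝓡 n) ∞ M₀] [T2Space M₀] [T2Space M]
    (R₀ : D.Realization M₀) {m₀ : M₀} {m : M} (hm : R₀.h m₀ = R.h m) : R₀.SameGerm m₀ R m := by
  set e₀ := chartAt (EuclideanSpace ℝ (Fin n)) m₀
  set e := chartAt (EuclideanSpace ℝ (Fin n)) m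
  have he₀ : e₀ ∈ IsManifold.maximalAtlas (𝓡 n) ∞ M₀ := IsManifold.chart_mem_maximalAtlas _
  have he : e ∈ IsManifold.maximalAtlas (𝓡 n) ∞ M := IsManifold.chart_mem_maximalAtlas _
  have hm₀s : m₀ ∈ e₀.source := mem_chart_source _ _
  have hms : m ∈ e.source := mem_chart_source _ _
  obtain ⟨f, hxf, hf0, hfU₀, hfU, hfs, hfs', hf⟩ := exists_local_equivalence
    (H₀ := fun x => R₀.h (e₀.symm x)) (H := fun y => R.h (e.symm y))
    (c := fun x => structureForm fun i j k => D.C i j k x) e₀.open_target e.open_target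
    (R₀.contDiffOn_chartForm he₀) (R.contDiffOn_chartForm he)
    (fun y hy => R₀.isInvertible_chartForm he₀ hy) (fun y hy => R.isInvertible_chartForm he hy)
    (fun y hy => R₀.curlEq_chartForm he₀ hy) (fun y hy => R.curlEq_chartForm he hy)
    (e₀.map_source hm₀s) (e.map_source hms) (by
      intro x u hu0 hu
      -- The common coefficients of the two `A`-paths: a radial solution satisfies `θ(u') = θ₀(x)`,
      -- so its image under `h` and the image of the ray under `h₀` obey the same ODE from the same
      -- point.
      set a : ℝ → Fin n → ℝ := fun t => R₀.chartForm e₀ (e₀ m₀ + t • x) x with ha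
      have hac : ContinuousOn a (Icc 0 1) := by
        refine ContinuousOn.clm_apply ((R₀.contDiffOn_chartForm he₀).continuousOn.comp
          (by fun_prop) fun t ht => (hu t ht).1) continuousOn_const
      have h1 : D.IsAnchored (fun t => R.h (e.symm (u t))) a 0 1 := by
        intro t ht
        obtain ⟨-, h3, u', h4, h5⟩ := hu t ht
        have := R.hasVelocityWithinAt_h_symm he h4 h3
        rwa [h5] at this
      have h2 : D.IsAnchored (fun t => R₀.h (e₀.symm (e₀ m₀ + t • x))) a 0 1 := by
        intro t ht
        refine R₀.hasVelocityWithinAt_h_symm he₀ (c := fun t => e₀ m₀ + t • x) ?_ (hu t ht).1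
        simpa using ((hasDerivWithinAt_id t (Icc (0 : ℝ) 1)).smul_const x).const_add (e₀ m₀)
      refine IsAnchored.eqOn hac h1 h2 ?_
      simp only [hu0, zero_smul, add_zero]
      rw [e.left_inv hms, e₀.left_inv hm₀s, hm])
  set φ := e₀.trans (f.trans e.symm) with hφ
  have hφs : ∀ q ∈ φ.source, q ∈ e₀.source ∧ e₀ q ∈ f.source ∧ f (e₀ q) ∈ e.target := by
    intro q hq
    simpa [hφ, OpenPartialHomeomorph.trans_source] using hq
  have hφt : ∀ p ∈ φ.target, p ∈ e.source ∧ e p ∈ f.target ∧ f.symm (e p) ∈ e₀.target := by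
    intro p hp
    have := φ.map_target hp
    have h1 := hφs _ this
    have h2 : φ (φ.symm p) = p := φ.right_inv hp
    have h3 : e.symm (f (e₀ (φ.symm p))) = p := h2
    have h4 : p ∈ e.source := h3 ▸ e.map_target h1.2.2
    have h5 : e p = f (e₀ (φ.symm p)) := by rw [← h3, e.right_inv h1.2.2, h3]
    refine ⟨h4, h5 ▸ f.map_source h1.2.1, ?_⟩
    rw [h5, f.left_inv h1.2.1]
    exact e₀.map_source h1.1
  refine ⟨φ, ?_, ?_, ?_, ?_, ?_⟩
  · have h1 := (contMDiffOn_symm_of_mem_maximalAtlas he).comp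
      (contMDiffOn_iff_contDiffOn.2 hfs) (fun x hx => hfU (f.map_source hx))
    have h2 := h1.comp ((contMDiffOn_of_mem_maximalAtlas he₀).mono fun q hq => (hφs q hq).1)
      fun q hq => (hφs q hq).2.1
    exact h2
  · have h1 := (contMDiffOn_symm_of_mem_maximalAtlas he₀).comp
      (contMDiffOn_iff_contDiffOn.2 hfs') (fun x hx => hfU₀ (f.map_target hx))
    have h2 := h1.comp ((contMDiffOn_of_mem_maximalAtlas he).mono fun q hq => (hφt q hq).1)
      fun q hq => (hφt q hq).2.1
    exact h2
  · rw [hφ, OpenPartialHomeomorph.trans_source, OpenPartialHomeomorph.trans_source]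
    exact ⟨hm₀s, hxf, hfU (f.map_source hxf)⟩
  · change e.symm (f (e₀ m₀)) = m
    rw [hf0, e.left_inv hms]
  · intro q hq
    obtain ⟨hq1, hq2, hq3⟩ := hφs q hq
    obtain ⟨hH, hθ⟩ := hf _ hq2
    refine ⟨?_, fun v => ?_⟩
    · change R.h (e.symm (f (e₀ q))) = R₀.h q
      rw [hH, e₀.left_inv hq1]
    · have hd1 := ((mdifferentiable_of_mem_maximalAtlas he₀).mdifferentiableAt hq1).hasMFDerivAt
      have hd2 := (((hfs.contDiffAt (f.open_source.mem_nhds hq2)).differentiableAt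
        (by simp)).hasFDerivAt).hasMFDerivAt
      have hd3 := ((mdifferentiable_of_mem_maximalAtlas he).mdifferentiableAt_symm hq3).hasMFDerivAt
      have hd := HasMFDerivAt.comp q hd3 (HasMFDerivAt.comp q hd2 hd1)
      have hφd : mfderiv (𝓡 n) (𝓡 n) φ q = _ := HasMFDerivAt.mfderiv hd
      rw [hφd, R₀.isChartForm_chartForm he₀ q hq1]
      exact hθ (mfderiv (𝓡 n) (𝓡 n) e₀ q v)

end Realization
end Data

/-! ### Realizations and orbits: projecting curves and lifting `A`-paths -/

namespace Data
variable {n d : ℕ} {X : Type u} [TopologicalSpace X]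
  [ChartedSpace (EuclideanSpace ℝ (Fin d)) X] [IsManifold (𝓡 d) ∞ X] {D : Data n d X}

theorem IsAnchored.mono {γ : ℝ → X} {a : ℝ → Fin n → ℝ} {α β α' β' : ℝ}
    (h : D.IsAnchored γ a α β) (hs : Icc α' β' ⊆ Icc α β) : D.IsAnchored γ a α' β' :=
  fun t ht => HasMFDerivWithinAt.mono (h t (hs ht)) hs

namespace Realization
variable {M : Type v} [TopologicalSpace M]
    [ChartedSpace (EuclideanSpace ℝ (Fin n)) M] [IsManifold (𝓡 n) ∞ M] (R : D.Realization M)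

/-- The straight segment from `p` to `q` in a chart is carried by `h` to an `A`-path, whose
coefficients are the values of the coframe on its velocity. -/
theorem eventually_aPathJoined (p : M) : ∀ᶠ q in 𝓝 p, D.APathJoined (R.h p) (R.h q) := by
  set e := chartAt (EuclideanSpace ℝ (Fin n)) p
  have he : e ∈ IsManifold.maximalAtlas (𝓡 n) ∞ M := IsManifold.chart_mem_maximalAtlas _
  have hp : p ∈ e.source := mem_chart_source _ _
  obtain ⟨r, hr, hball⟩ := Metric.mem_nhds_iff.1 (e.open_target.mem_nhds (e.map_source hp))
  have h1 : ∀ᶠ q in 𝓝 p, e q ∈ ball (e p) r :=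
    (e.continuousAt hp).eventually_mem (ball_mem_nhds _ hr)
  filter_upwards [h1, e.open_source.mem_nhds hp] with q hq hqs
  set w := e q - e p with hw
  set c : ℝ → EuclideanSpace ℝ (Fin n) := fun t => e p + t • w with hc
  have hct : ∀ t ∈ Icc (0 : ℝ) 1, c t ∈ e.target := by
    intro t ht
    apply hball
    have := (convex_ball (e p) r).add_smul_sub_mem (mem_ball_self hr) hq ht
    exact this
  have hcs : ContDiff ℝ ∞ c := by fun_prop
  refine ⟨fun t => R.h (e.symm (c t)), fun t => R.chartForm e (c t) w, ?_, ?_, ?_, ?_, ?_⟩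
  · exact R.smooth_h.comp_contMDiffOn ((contMDiffOn_symm_of_mem_maximalAtlas he).comp
      (contMDiff_iff_contDiff.2 hcs).contMDiffOn hct)
  · exact ((R.contDiffOn_chartForm he).comp hcs.contDiffOn hct).clm_apply contDiffOn_const
  · simp only [hc, zero_smul, add_zero]
    rw [e.left_inv hp]
  · simp only [hc, one_smul, hw, add_sub_cancel]
    rw [e.left_inv hqs]
  · intro t ht
    refine R.hasVelocityWithinAt_h_symm he (c := c) ?_ (hct t ht)
    have h := ((hasDerivWithinAt_id t (Icc (0 : ℝ) 1)).smul_const w).const_add (e p)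
    rw [one_smul] at h
    exact h

/-- On a connected realization, `h` takes values in one orbit. -/
theorem sameOrbit [PreconnectedSpace M] (p q : M) : D.SameOrbit (R.h p) (R.h q) := by
  have hclopen : IsClopen {q | D.SameOrbit (R.h p) (R.h q)} := by
    constructor
    · rw [← isOpen_compl_iff, isOpen_iff_mem_nhds]
      intro q hq
      filter_upwards [R.eventually_aPathJoined q] with q' hq' hmem
      exact hq (Relation.EqvGen.trans _ _ _ hmem
        (Relation.EqvGen.symm _ _ (Relation.EqvGen.rel _ _ hq')))
    · rw [isOpen_iff_mem_nhds]
      intro q hq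
      filter_upwards [R.eventually_aPathJoined q] with q' hq'
      exact Relation.EqvGen.trans _ _ _ hq (Relation.EqvGen.rel _ _ hq')
  have := hclopen.eq_univ ⟨p, Relation.EqvGen.refl _⟩
  have hq : q ∈ {q | D.SameOrbit (R.h p) (R.h q)} := by rw [this]; trivial
  exact hq

/-- An `A`-path which meets the range of `h` stays in it for a short time. -/
theorem eventually_mem_range_h {γ : ℝ → X} {a : ℝ → Fin n → ℝ} {α β t₀ : ℝ}
    (ha : ContinuousOn a (Icc α β)) (h : D.IsAnchored γ a α β) (ht₀ : t₀ ∈ Icc α β)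
    {p : M} (hp : R.h p = γ t₀) : ∀ᶠ t in 𝓝[Icc α β] t₀, γ t ∈ range R.h := by
  set e := chartAt (EuclideanSpace ℝ (Fin n)) p
  have he : e ∈ IsManifold.maximalAtlas (𝓡 n) ∞ M := IsManifold.chart_mem_maximalAtlas _
  have hps : p ∈ e.source := mem_chart_source _ _
  obtain ⟨ρ, hρ, hball⟩ := Metric.nhds_basis_closedBall.mem_iff.1
    (e.open_target.mem_nhds (e.map_source hps))
  -- The path is lifted by solving `u' = θ(u)⁻¹ a(t)` from `p`. Then `h ∘ u` is anchored with the
  -- coefficients of `γ` and meets `γ` at `t₀`, so it coincides with `γ` near `t₀`.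
  set B : EuclideanSpace ℝ (Fin n) → (Fin n → ℝ) →L[ℝ] EuclideanSpace ℝ (Fin n) :=
    fun y => (R.chartForm e y).inverse with hB
  have hBs : ContDiffOn ℝ ∞ B (closedBall (e p) ρ) := by
    intro y hy
    obtain ⟨e', he'⟩ := R.isInvertible_chartForm he (hball hy)
    have h3 : ContDiffAt ℝ ∞ ContinuousLinearMap.inverse (R.chartForm e y) :=
      he' ▸ contDiffAt_map_inverse e'
    exact h3.comp_contDiffWithinAt y ((R.contDiffOn_chartForm he).mono hball y hy)
  obtain ⟨K₁, hK₁⟩ := hBs.exists_lipschitzOnWith (by simp) (convex_closedBall _ _)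
    (isCompact_closedBall _ _)
  obtain ⟨K₂, hK₂⟩ : ∃ K₂ : NNReal, ∀ y ∈ closedBall (e p) ρ, ‖B y‖ ≤ K₂ := by
    obtain ⟨C, hC⟩ := (isCompact_closedBall (e p) ρ).exists_bound_of_continuousOn hBs.continuousOn
    exact ⟨C.toNNReal, fun y hy => (hC y hy).trans (Real.le_coe_toNNReal C)⟩
  obtain ⟨A, hA⟩ : ∃ A : NNReal, ∀ t ∈ Icc α β, ‖a t‖ ≤ A := by
    obtain ⟨C, hC⟩ := isCompact_Icc.exists_bound_of_continuousOn ha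
    exact ⟨C.toNNReal, fun y hy => (hC y hy).trans (Real.le_coe_toNNReal C)⟩
  -- The lift has speed at most `K₂ * A`, so it stays in the ball of radius `ρ` for time `ε`; the
  -- added `1` keeps the denominator positive. The time interval is then cut to `[α, β]`, so `t₀`
  -- may be an endpoint.
  set ε : ℝ := ρ / (K₂ * A + 1) with hε
  have hK0 : (0 : ℝ) ≤ K₂ * A := by positivity
  have hεpos : 0 < ε := by positivity
  have hεle : K₂ * A * ε ≤ ρ := by
    rw [hε, mul_div_assoc', div_le_iff₀ (by positivity)]
    nlinarith
  set α' := max α (t₀ - ε) with hα'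
  set β' := min β (t₀ + ε) with hβ'
  have hsub : Icc α' β' ⊆ Icc α β := Icc_subset_Icc (le_max_left _ _) (min_le_left _ _)
  have ht₀' : t₀ ∈ Icc α' β' :=
    ⟨max_le ht₀.1 (by linarith), le_min ht₀.2 (by linarith)⟩
  have hnhds : 𝓝[Icc α' β'] t₀ = 𝓝[Icc α β] t₀ := by
    have : Icc α' β' = Icc (t₀ - ε) (t₀ + ε) ∩ Icc α β := by
      rw [Icc_inter_Icc, hα', hβ', max_comm, min_comm]
    rw [this]
    exact nhdsWithin_inter_of_mem (nhdsWithin_le_nhds (Icc_mem_nhds (by linarith) (by linarith)))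
  have hpl : IsPicardLindelof (fun t y => B y (a t)) (⟨t₀, ht₀'⟩ : Icc α' β') (e p)
      ρ.toNNReal 0 (K₂ * A) (K₁ * A) := by
    have hρ' : (ρ.toNNReal : ℝ) = ρ := Real.coe_toNNReal _ hρ.le
    refine ⟨fun t ht => ?_, fun y hy => ?_, fun t ht y hy => ?_, ?_⟩
    · rw [hρ']
      refine LipschitzOnWith.of_dist_le_mul fun y₁ hy₁ y₂ hy₂ => ?_
      rw [dist_eq_norm, ← _root_.sub_apply, NNReal.coe_mul]
      calc _ ≤ ‖B y₁ - B y₂‖ * ‖a t‖ := ContinuousLinearMap.le_opNorm _ _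
        _ ≤ (K₁ * dist y₁ y₂) * A := by
            rw [← dist_eq_norm]
            gcongr
            · exact hK₁.dist_le_mul _ hy₁ _ hy₂
            · exact hA t (hsub ht)
        _ = _ := by ring
    · exact (B y).continuous.comp_continuousOn (ha.mono hsub)
    · rw [hρ'] at hy
      rw [NNReal.coe_mul]
      refine (ContinuousLinearMap.le_opNorm _ _).trans ?_
      gcongr
      exacts [hK₂ y hy, hA t (hsub ht)]
    · rw [NNReal.coe_mul, hρ', NNReal.coe_zero, sub_zero]
      refine le_trans ?_ hεle
      gcongr
      exact max_le (by linarith [min_le_right β (t₀ + ε)]) (by linarith [le_max_right α (t₀ - ε)])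
  obtain ⟨u, hu0, hu⟩ := exists_solution_mem_closedBall hpl
  have huan : D.IsAnchored (fun t => R.h (e.symm (u t))) a α' β' := by
    intro t ht
    have hut : u t ∈ e.target := by
      apply hball
      have := (hu t ht).2
      rwa [Real.coe_toNNReal _ hρ.le] at this
    have h1 := R.hasVelocityWithinAt_h_symm he (hu t ht).1 hut
    have h2 : R.chartForm e (u t) (B (u t) (a t)) = a t := by
      obtain ⟨e', he'⟩ := R.isInvertible_chartForm he hut
      rw [hB]
      simp only [← he', ContinuousLinearMap.inverse_equiv]
      exact e'.apply_symm_apply _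
    rwa [h2] at h1
  have heq := IsAnchored.eventuallyEq (ha.mono hsub) (h.mono hsub) huan ht₀' (by
    have : u t₀ = e p := hu0
    rw [this, e.left_inv hps, hp])
  rw [hnhds] at heq
  filter_upwards [heq] with t ht
  exact ⟨_, ht.symm⟩

end Realization
end Data

/-! ### The coframe dual to a frame -/

/-- The linear map `a ↦ ∑ aⁱ Eᵢ` of a family of vectors. -/
def frameMap {n : ℕ} {V : Type*} [NormedAddCommGroup V] [NormedSpace ℝ V] (E : Fin n → V) :
    (Fin n → ℝ) →L[ℝ] V :=
  ∑ i, (ContinuousLinearMap.proj (R := ℝ) (φ := fun _ : Fin n => ℝ) i).smulRight (E i)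

section
variable {n : ℕ} {V : Type*} [NormedAddCommGroup V] [NormedSpace ℝ V]

theorem frameMap_apply (E : Fin n → V) (a : Fin n → ℝ) : frameMap E a = ∑ i, a i • E i := by
  simp [frameMap]

theorem contDiffOn_frameMap {E : Fin n → V → V} {U : Set V}
    (hE : ∀ i, ContDiffOn ℝ ∞ (E i) U) :
    ContDiffOn ℝ ∞ (fun y => frameMap fun i => E i y) U := by
  rw [contDiffOn_clm_apply]
  intro a
  simp only [frameMap_apply]
  exact ContDiffOn.sum fun i _ => contDiffOn_const.smul (hE i)

theorem contDiffOn_inverse_frameMap [CompleteSpace V] {E : Fin n → V → V} {U : Set V}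
    (hE : ∀ i, ContDiffOn ℝ ∞ (E i) U)
    (hinv : ∀ y ∈ U, (frameMap fun i => E i y).IsInvertible) :
    ContDiffOn ℝ ∞ (fun y => (frameMap fun i => E i y).inverse) U := by
  intro y hy
  obtain ⟨e, he⟩ := hinv y hy
  have h3 : ContDiffAt ℝ ∞ ContinuousLinearMap.inverse (frameMap fun i => E i y) :=
    he ▸ contDiffAt_map_inverse e
  exact h3.comp_contDiffWithinAt y (contDiffOn_frameMap hE y hy)

/-- By antisymmetry the diagonal terms vanish, and exchanging the indices turns the terms with `j <
i` into the negative part of the wedge terms with `i < j`. -/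
theorem structureForm_eq_sum {C : Fin n → Fin n → Fin n → ℝ} (hC : ∀ i j k, C i j k = -C j i k)
    (a b : Fin n → ℝ) (k : Fin n) : structureForm C a b k = ∑ i, ∑ j, a i * b j * C i j k := by
  have h0 : ∀ i, C i i k = 0 := fun i => by linarith [hC i i k]
  have h1 : ∀ i j, a i * b j * C i j k =
      (if i < j then C i j k * (a i * b j) else 0) + (if j < i then C i j k * (a i * b j) else 0) := by
    intro i j
    rcases lt_trichotomy i j with h | h | h
    · simp [h, h.not_gt]; ring
    · simp [h, h0]
    · simp [h, h.not_gt]; ring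
  have h2 : ∑ i, ∑ j, (if j < i then C i j k * (a i * b j) else 0) =
      ∑ i, ∑ j, if i < j then -(C i j k * (b i * a j)) else 0 := by
    rw [Finset.sum_comm]
    refine Finset.sum_congr rfl fun i _ => Finset.sum_congr rfl fun j _ => ?_
    rw [hC j i k]
    split_ifs <;> ring
  simp only [h1, Finset.sum_add_distrib]
  rw [h2, ← Finset.sum_add_distrib]
  refine Finset.sum_congr rfl fun i _ => ?_
  rw [← Finset.sum_add_distrib]
  refine Finset.sum_congr rfl fun j _ => ?_
  split_ifs <;> ring

/-- The structure equation of the coframe dual to a frame with given brackets. -/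
theorem curlEq_inverse_frameMap [CompleteSpace V] {E : Fin n → V → V} {U : Set V} (hU : IsOpen U)
    (hE : ∀ i, ContDiffOn ℝ ∞ (E i) U)
    (hinv : ∀ y ∈ U, (frameMap fun i => E i y).IsInvertible)
    {C : Fin n → Fin n → Fin n → ℝ} (hC : ∀ i j k, C i j k = -C j i k) {y : V} (hy : y ∈ U)
    (hbr : ∀ i j, VectorField.lieBracket ℝ (E i) (E j) y = -∑ k, C i j k • E k y) :
    CurlEq (fun y => (frameMap fun i => E i y).inverse) (structureForm C) y := by
  set A : V → (Fin n → ℝ) →L[ℝ] V := fun y => frameMap fun i => E i y with hA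
  set ϑ : V → V →L[ℝ] (Fin n → ℝ) := fun y => (A y).inverse with hϑ
  have hAd : HasFDerivAt A (fderiv ℝ A y) y :=
    (((contDiffOn_frameMap hE).contDiffAt (hU.mem_nhds hy)).differentiableAt (by simp)).hasFDerivAt
  have hϑd : HasFDerivAt ϑ (fderiv ℝ ϑ y) y :=
    (((contDiffOn_inverse_frameMap hE hinv).contDiffAt (hU.mem_nhds hy)).differentiableAt
      (by simp)).hasFDerivAt
  have hEd : ∀ i, HasFDerivAt (E i) (fderiv ℝ (E i) y) y := fun i =>
    (((hE i).contDiffAt (hU.mem_nhds hy)).differentiableAt (by simp)).hasFDerivAt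
  have hl : ∀ z ∈ U, ∀ a, ϑ z (A z a) = a := by
    intro z hz a
    obtain ⟨e, he⟩ := hinv z hz
    have he' : A z = e := he.symm
    change (A z).inverse (A z a) = a
    rw [he', ContinuousLinearMap.inverse_equiv]
    exact e.symm_apply_apply a
  have hr : ∀ v, A y (ϑ y v) = v := by
    intro v
    obtain ⟨e, he⟩ := hinv y hy
    have he' : A y = e := he.symm
    change A y ((A y).inverse v) = v
    rw [he', ContinuousLinearMap.inverse_equiv]
    exact e.apply_symm_apply v
  have hA' : ∀ v a, fderiv ℝ A y v a = ∑ i, a i • fderiv ℝ (E i) y v := by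
    intro v a
    have h1 := hAd.clm_apply (hasFDerivAt_const a y)
    have h2 : HasFDerivAt (fun z => A z a) (∑ i, a i • fderiv ℝ (E i) y) y := by
      simp only [hA, frameMap_apply]
      exact HasFDerivAt.fun_sum fun i _ => (hEd i).const_smul (a i)
    have := DFunLike.congr_fun (h1.unique h2) v
    simpa [sum_apply] using this
  -- Differentiate `ϑ (A a) = a` with constant coefficients `a`. It expresses the curl of the dual
  -- coframe through derivatives of the frame, that is through its brackets.
  have hϑ' : ∀ v a, fderiv ℝ ϑ y v (A y a) = -ϑ y (fderiv ℝ A y v a) := by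
    intro v a
    have h1 := hϑd.clm_apply (hAd.clm_apply (hasFDerivAt_const a y))
    have h2 : HasFDerivAt (fun z => ϑ z (A z a)) (0 : V →L[ℝ] (Fin n → ℝ)) y :=
      (hasFDerivAt_const a y).congr_of_eventuallyEq
        (Filter.eventually_of_mem (hU.mem_nhds hy) fun z hz => hl z hz a)
    have := DFunLike.congr_fun (h1.unique h2) v
    simp at this
    rw [eq_neg_iff_add_eq_zero, add_comm]
    exact this
  intro v w
  set a := ϑ y v with ha
  set b := ϑ y w with hb
  rw [← hr v, ← hr w, ← ha, ← hb, hϑ', hϑ', neg_sub_neg, ← map_sub]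
  have h3 : fderiv ℝ A y (A y b) a - fderiv ℝ A y (A y a) b =
      A y (structureForm C a b) := by
    have h4 : A y a = ∑ i, a i • E i y := frameMap_apply _ _
    have h5 : A y b = ∑ i, b i • E i y := frameMap_apply _ _
    rw [hA', hA', h4, h5]
    have h6 : ∀ i j, fderiv ℝ (E i) y (E j y) - fderiv ℝ (E j) y (E i y) =
        ∑ k, C i j k • E k y := by
      intro i j
      have := hbr i j
      rw [VectorField.lieBracket] at this
      rw [← neg_sub, this, neg_neg]
    calc _ = ∑ i, ∑ j, (a i * b j) •
          (fderiv ℝ (E i) y (E j y) - fderiv ℝ (E j) y (E i y)) := by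
          simp only [map_sum, map_smul, smul_sub, Finset.sum_sub_distrib, Finset.smul_sum, smul_smul]
          congr 1
          rw [Finset.sum_comm]
          refine Finset.sum_congr rfl fun i _ => Finset.sum_congr rfl fun j _ => ?_
          rw [mul_comm]
      _ = _ := by
          rw [hA]
          simp only [frameMap_apply, structureForm_eq_sum hC, h6, Finset.sum_smul, Finset.smul_sum,
            smul_smul]
          conv_rhs => rw [Finset.sum_comm]
          refine Finset.sum_congr rfl fun i _ => ?_
          rw [Finset.sum_comm]
  rw [h3, hl y hy]

end

/-! ### Realizations from coordinate expressions -/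

namespace Data
variable {n d : ℕ} {X : Type u} [TopologicalSpace X]
  [ChartedSpace (EuclideanSpace ℝ (Fin d)) X] [IsManifold (𝓡 d) ∞ X] {D : Data n d X}

/-- Near any tangent vector, `θ` is the smooth form `ϑ ∘ e` on the base applied to the fibre
component of the tangent map of `e`. -/
theorem contMDiff_of_isChartForm {M : Type v} [TopologicalSpace M]
    [ChartedSpace (EuclideanSpace ℝ (Fin n)) M] [IsManifold (𝓡 n) ∞ M]
    {θ : ∀ p : M, TangentSpace (𝓡 n) p →L[ℝ] (Fin n → ℝ)}
    (hch : ∀ p : M, ∃ e ∈ IsManifold.maximalAtlas (𝓡 n) ∞ M, p ∈ e.source ∧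
      ∃ ϑ, ContDiffOn ℝ ∞ ϑ e.target ∧ IsChartForm e θ ϑ) :
    ContMDiff (𝓡 n).tangent 𝓘(ℝ, Fin n → ℝ) ∞
      (fun w : TangentBundle (𝓡 n) M => θ w.proj w.snd) := by
  intro w₀
  obtain ⟨e, he, hp, ϑ, hϑ, hθ⟩ := hch w₀.proj
  have h1 : ContMDiffOn (𝓡 n).tangent (𝓡 n).tangent ∞
      (tangentMapWithin (𝓡 n) (𝓡 n) e e.source) (Bundle.TotalSpace.proj ⁻¹' e.source) :=
    (contMDiffOn_of_mem_maximalAtlas he).contMDiffOn_tangentMapWithin (by simp)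
      e.open_source.uniqueMDiffOn
  have h2 : ContMDiffOn (𝓡 n).tangent 𝓘(ℝ, EuclideanSpace ℝ (Fin n)) ∞
      (fun w : TangentBundle (𝓡 n) M => (tangentMapWithin (𝓡 n) (𝓡 n) e e.source w).snd)
      (Bundle.TotalSpace.proj ⁻¹' e.source) :=
    (contMDiff_snd_tangentBundle_modelSpace (EuclideanSpace ℝ (Fin n)) (𝓡 n)).comp_contMDiffOn h1
  have h3 : ContMDiffOn (𝓡 n).tangent 𝓘(ℝ, EuclideanSpace ℝ (Fin n) →L[ℝ] (Fin n → ℝ)) ∞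
      (fun w : TangentBundle (𝓡 n) M => ϑ (e w.proj)) (Bundle.TotalSpace.proj ⁻¹' e.source) :=
    (hϑ.contMDiffOn.comp (contMDiffOn_of_mem_maximalAtlas he) fun q hq => e.map_source hq).comp
      (Bundle.contMDiff_proj (TangentSpace (𝓡 n))).contMDiffOn fun w hw => hw
  have hopen : IsOpen (Bundle.TotalSpace.proj ⁻¹' e.source : Set (TangentBundle (𝓡 n) M)) :=
    e.open_source.preimage (FiberBundle.continuous_proj _ _)
  refine ((h3.clm_apply h2).contMDiffAt (hopen.mem_nhds hp)).congr_of_eventuallyEq ?_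
  filter_upwards [hopen.mem_nhds hp] with w hw
  rw [hθ _ hw]
  congr 1
  change _ = mfderivWithin (𝓡 n) (𝓡 n) e e.source w.proj w.snd
  rw [mfderivWithin_of_isOpen e.open_source hw]

/-- A realization from its coordinate expressions. -/
def Realization.ofCharts {M : Type v} [TopologicalSpace M]
    [ChartedSpace (EuclideanSpace ℝ (Fin n)) M] [IsManifold (𝓡 n) ∞ M]
    (θ : ∀ p : M, TangentSpace (𝓡 n) p →L[ℝ] (Fin n → ℝ)) (h : M → X)
    (smooth_h : ContMDiff (𝓡 n) (𝓡 d) ∞ h) (coframe : ∀ p, Function.Bijective (θ p))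
    (dh_eq : ∀ (p : M) (v : TangentSpace (𝓡 n) p),
      mfderiv (𝓡 n) (𝓡 d) h p v = D.anchor (h p) (θ p v))
    (hch : ∀ p : M, ∃ e ∈ IsManifold.maximalAtlas (𝓡 n) ∞ M, p ∈ e.source ∧
      ∃ ϑ, ContDiffOn ℝ ∞ ϑ e.target ∧ IsChartForm e θ ϑ ∧
        ∀ y ∈ e.target, CurlEq ϑ (structureForm fun i j k => D.C i j k (h (e.symm y))) y) :
    D.Realization M where
  θ := θ
  h := h
  smooth_h := smooth_h
  coframe := coframe
  dh_eq := dh_eq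
  smooth_θ := contMDiff_of_isChartForm fun p => by
    obtain ⟨e, he, hp, ϑ, h1, h2, -⟩ := hch p
    exact ⟨e, he, hp, ϑ, h1, h2⟩
  structure_eq := by
    intro V W hV hW k p
    obtain ⟨e, he, hp, ϑ, h1, h2, h3⟩ := hch p
    rw [exteriorDerivative_eq_chart he h2 hp
      ((h1.contDiffAt (e.open_target.mem_nhds (e.map_source hp))).differentiableAt (by simp))
      hV hW k]
    have h4 := congrFun (h3 (e p) (e.map_source hp) (chartField e V (e p)) (chartField e W (e p))) k
    have h5 : ∀ Z : (∀ p : M, TangentSpace (𝓡 n) p),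
        ϑ (e p) (chartField e Z (e p)) = θ p (Z p) := fun Z => by
      rw [h2 p hp]
      unfold chartField
      rw [e.left_inv hp]
    rw [h5, h5, e.left_inv hp] at h4
    exact h4

end Data

/-! ### Fibres of a submersion as manifolds -/

open Manifold

section
variable {m l n : ℕ} {G : Type*} {L : Type*} [TopologicalSpace G]
  [ChartedSpace (EuclideanSpace ℝ (Fin m)) G]
  [TopologicalSpace L] [ChartedSpace (EuclideanSpace ℝ (Fin l)) L]
  {f : G → L}

section
variable {F : Type*} [NormedAddCommGroup F] [NormedSpace ℝ F]

theorem codChart_apply_eq {x : G} (h : IsSubmersionAtOfComplement F (𝓡 m) (𝓡 l) ∞ f x) {g : G}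
    (hg : g ∈ h.domChart.source) : h.codChart (f g) = (h.equiv (h.domChart g)).1 := by
  have h1 : h.domChart g ∈ (h.domChart.extend (𝓡 m)).target := by
    simpa using h.domChart.map_source hg
  have := h.writtenInCharts h1
  simpa [h.domChart.left_inv hg] using this

/-- The kernel of the differential of a submersion, in a submersion chart. -/
theorem mfderiv_eq_zero_iff [IsManifold (𝓡 m) ∞ G] [IsManifold (𝓡 l) ∞ L] {x : G}
    (h : IsSubmersionAtOfComplement F (𝓡 m) (𝓡 l) ∞ f x)
    {g : G} (hg : g ∈ h.domChart.source) (v : TangentSpace (𝓡 m) g) :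
    mfderiv (𝓡 m) (𝓡 l) f g v = 0 ↔
      (h.equiv (mfderiv (𝓡 m) (𝓡 m) h.domChart g v)).1 = 0 := by
  have hφ := mdifferentiable_of_mem_maximalAtlas h.domChart_mem_maximalAtlas
  have hψ := mdifferentiable_of_mem_maximalAtlas h.codChart_mem_maximalAtlas
  have hfg := h.source_subset_preimage_source hg
  have hd : MDifferentiableAt (𝓡 m) (𝓡 l) f g :=
    (h.contMDiffOn.contMDiffAt (h.domChart.open_source.mem_nhds hg)).mdifferentiableAt (by simp)
  have h1 := HasMFDerivAt.comp g (hψ.mdifferentiableAt hfg).hasMFDerivAt hd.hasMFDerivAt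
  set κ : EuclideanSpace ℝ (Fin m) →L[ℝ] EuclideanSpace ℝ (Fin l) :=
    (ContinuousLinearMap.fst ℝ (EuclideanSpace ℝ (Fin l)) F).comp
      h.equiv.toContinuousLinearMap with hκ
  have h2 : HasMFDerivAt (𝓡 m) 𝓘(ℝ, EuclideanSpace ℝ (Fin l)) (h.codChart ∘ f) g
      (κ.comp (mfderiv (𝓡 m) (𝓡 m) h.domChart g)) := by
    refine HasMFDerivAt.congr_of_eventuallyEq (HasMFDerivAt.comp g
      (κ.hasFDerivAt (x := h.domChart g)).hasMFDerivAt
      (hφ.mdifferentiableAt hg).hasMFDerivAt) ?_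
    filter_upwards [h.domChart.open_source.mem_nhds hg] with p hp
    exact codChart_apply_eq h hp
  have h3 := DFunLike.congr_fun (hasMFDerivAt_unique h1 h2) v
  have h4 := hψ.mfderiv_injective hfg
  change mfderiv (𝓡 l) (𝓡 l) h.codChart (f g) (mfderiv (𝓡 m) (𝓡 l) f g v) =
    (h.equiv (mfderiv (𝓡 m) (𝓡 m) h.domChart g v)).1 at h3
  rw [← h3]
  exact (map_eq_zero_iff _ h4).symm

end

/-- `e` is a slice chart of `T`, seen by `j` as a fibre of `f`, adapted to the chart `φ`. -/
structure IsSliceChart (l : ℕ) {L : Type*} [TopologicalSpace L]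
    [ChartedSpace (EuclideanSpace ℝ (Fin l)) L] (f : G → L) {T : Type*} [TopologicalSpace T] (j : T → G)
    (e : OpenPartialHomeomorph T (EuclideanSpace ℝ (Fin n)))
    (φ : OpenPartialHomeomorph G (EuclideanSpace ℝ (Fin m)))
    (π : EuclideanSpace ℝ (Fin m) →L[ℝ] EuclideanSpace ℝ (Fin n))
    (ι : EuclideanSpace ℝ (Fin n) →L[ℝ] EuclideanSpace ℝ (Fin m))
    (b : EuclideanSpace ℝ (Fin m)) : Prop where
  mem : φ ∈ IsManifold.maximalAtlas (𝓡 m) ∞ G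
  map_source : ∀ q ∈ e.source, j q ∈ φ.source
  apply_eq : ∀ q ∈ e.source, e q = π (φ (j q))
  chart_eq : ∀ q ∈ e.source, φ (j q) = b + ι (e q)
  proj_incl : ∀ z, π (ι z) = z
  incl_proj : ∀ q ∈ e.source, ∀ v : TangentSpace (𝓡 m) (j q), mfderiv (𝓡 m) (𝓡 l) f (j q) v = 0 →
    ι (π (mfderiv (𝓡 m) (𝓡 m) φ (j q) v)) = mfderiv (𝓡 m) (𝓡 m) φ (j q) v

variable {y : L} {W : Set G}

open Classical in
/-- The chart of (an open part of) a fibre of a submersion given by a submersion chart. -/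
def sliceChart (hW : IsOpen W) (x : {g : G // f g = y ∧ g ∈ W})
    (h : IsSubmersionAtOfComplement (EuclideanSpace ℝ (Fin n)) (𝓡 m) (𝓡 l) ∞ f (x : G)) :
    OpenPartialHomeomorph {g : G // f g = y ∧ g ∈ W} (EuclideanSpace ℝ (Fin n)) := by
  have hy : y ∈ h.codChart.source := by
    have := h.mem_codChart_source
    rwa [show f x = y from x.2.1] at this
  have hc : Continuous fun z : EuclideanSpace ℝ (Fin n) => h.equiv.symm (h.codChart y, z) := by
    fun_prop
  have hf : ∀ z : EuclideanSpace ℝ (Fin n), h.equiv.symm (h.codChart y, z) ∈ h.domChart.target →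
      f (h.domChart.symm (h.equiv.symm (h.codChart y, z))) = y := by
    intro z hz
    have h1 := h.domChart.map_target hz
    refine h.codChart.injOn (h.source_subset_preimage_source h1) hy ?_
    rw [codChart_apply_eq h h1, h.domChart.right_inv hz, h.equiv.apply_symm_apply]
  have hl : ∀ g : {g : G // f g = y ∧ g ∈ W}, (g : G) ∈ h.domChart.source →
      h.equiv.symm (h.codChart y, (h.equiv (h.domChart g)).2) = h.domChart g := by
    intro g hg
    have h1 := codChart_apply_eq h hg
    rw [show f g = y from g.2.1] at h1
    rw [h1, Prod.mk.eta, h.equiv.symm_apply_apply]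
  have hmem : ∀ z, z ∈ (fun z => h.equiv.symm (h.codChart y, z)) ⁻¹'
      (h.domChart.target ∩ h.domChart.symm ⁻¹' W) → h.equiv.symm (h.codChart y, z) ∈
        h.domChart.target ∧ h.domChart.symm (h.equiv.symm (h.codChart y, z)) ∈ W :=
    fun z hz => hz
  exact
  { toFun := fun g => (h.equiv (h.domChart g)).2
    -- Outside the target the inverse takes the default value `x`. Membership in `W` is part of the
    -- condition because the chart lives on an open part of the fibre.
    invFun := fun z => if hz : h.equiv.symm (h.codChart y, z) ∈ h.domChart.target ∧
        h.domChart.symm (h.equiv.symm (h.codChart y, z)) ∈ W then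
      ⟨h.domChart.symm (h.equiv.symm (h.codChart y, z)), hf z hz.1, hz.2⟩ else x
    source := Subtype.val ⁻¹' h.domChart.source
    target := (fun z => h.equiv.symm (h.codChart y, z)) ⁻¹'
      (h.domChart.target ∩ h.domChart.symm ⁻¹' W)
    map_source' := by
      intro g hg
      simp only [mem_preimage] at hg ⊢
      rw [hl g hg]
      refine ⟨h.domChart.map_source hg, ?_⟩
      rw [mem_preimage, h.domChart.left_inv hg]
      exact g.2.2
    map_target' := by
      intro z hz
      simp only [mem_preimage]
      rw [dif_pos (hmem z hz)]
      exact h.domChart.map_target hz.1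
    left_inv' := by
      intro g hg
      apply Subtype.ext
      simp only [mem_preimage] at hg
      simp only [hl g hg, h.domChart.left_inv hg]
      rw [dif_pos ⟨h.domChart.map_source hg, g.2.2⟩]
    right_inv' := by
      intro z hz
      rw [dif_pos (hmem z hz)]
      change (h.equiv (h.domChart (h.domChart.symm _))).2 = z
      rw [h.domChart.right_inv hz.1, h.equiv.apply_symm_apply]
    open_source := h.domChart.open_source.preimage continuous_subtype_val
    open_target := (h.domChart.symm.isOpen_inter_preimage hW).preimage hc
    continuousOn_toFun := by
      refine (continuous_snd.comp h.equiv.continuous).comp_continuousOn ?_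
      exact h.domChart.continuousOn.comp continuous_subtype_val.continuousOn fun g hg => hg
    continuousOn_invFun := by
      refine (Topology.IsInducing.continuousOn_iff (Topology.IsInducing.subtypeVal
        (t := {g | f g = y ∧ g ∈ W}))).2 ?_
      refine (h.domChart.continuousOn_symm.comp hc.continuousOn fun z hz => hz.1).congr ?_
      intro z hz
      simp only [Function.comp_apply]
      rw [dif_pos (hmem z hz)] }

/-- In submersion charts `f` is the first projection: its fibre is the affine slice with first
coordinate `codChart y`, and the kernel of its differential is the second factor, which is the image
of the inclusion. -/
theorem isSliceChart_sliceChart [IsManifold (𝓡 m) ∞ G] [IsManifold (𝓡 l) ∞ L] (hW : IsOpen W)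
    (x : {g : G // f g = y ∧ g ∈ W})
    (h : IsSubmersionAtOfComplement (EuclideanSpace ℝ (Fin n)) (𝓡 m) (𝓡 l) ∞ f (x : G)) :
    IsSliceChart l f Subtype.val (sliceChart hW x h) h.domChart
      ((ContinuousLinearMap.snd ℝ _ _).comp h.equiv.toContinuousLinearMap)
      (h.equiv.symm.toContinuousLinearMap.comp (ContinuousLinearMap.inr ℝ _ _))
      (h.equiv.symm (h.codChart y, 0)) where
  mem := h.domChart_mem_maximalAtlas
  map_source q hq := hq
  apply_eq q hq := rfl
  chart_eq q hq := by
    change _ = h.equiv.symm (h.codChart y, 0) + h.equiv.symm (0, (h.equiv (h.domChart q)).2)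
    have h1 := codChart_apply_eq h hq
    rw [show f q = y from q.2.1] at h1
    rw [← map_add, Prod.mk_add_mk, add_zero, zero_add, h1, Prod.mk.eta, h.equiv.symm_apply_apply]
  proj_incl z := by simp
  incl_proj q hq v hv := by
    rw [mfderiv_eq_zero_iff h hq] at hv
    change h.equiv.symm (0, (h.equiv (mfderiv (𝓡 m) (𝓡 m) h.domChart q v)).2) = _
    rw [← hv, Prod.mk.eta]
    exact h.equiv.symm_apply_apply _

/-- The manifold structure of an open part of a fibre of a submersion. -/
abbrev sliceChartedSpace (hW : IsOpen W)
    (h : IsSubmersionOfComplement (EuclideanSpace ℝ (Fin n)) (𝓡 m) (𝓡 l) ∞ f) :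
    ChartedSpace (EuclideanSpace ℝ (Fin n)) {g : G // f g = y ∧ g ∈ W} where
  atlas := range fun x => sliceChart hW x (h x)
  chartAt x := sliceChart hW x (h x)
  mem_chart_source x := (h x).mem_domChart_source
  chart_mem_atlas x := mem_range_self x

/-- The transition map is `π' ∘ φ' ∘ φ⁻¹ ∘ (b + ι ·)`, a smooth coordinate change of `G` between an
affine and a linear map. -/
theorem IsSliceChart.contDiffOn_transition {T : Type*} [TopologicalSpace T] {j : T → G}
    {e e' : OpenPartialHomeomorph T (EuclideanSpace ℝ (Fin n))}
    {φ φ' : OpenPartialHomeomorph G (EuclideanSpace ℝ (Fin m))}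
    {π π' : EuclideanSpace ℝ (Fin m) →L[ℝ] EuclideanSpace ℝ (Fin n)}
    {ι ι' : EuclideanSpace ℝ (Fin n) →L[ℝ] EuclideanSpace ℝ (Fin m)}
    {b b' : EuclideanSpace ℝ (Fin m)} [IsManifold (𝓡 m) ∞ G]
    (h : IsSliceChart l f j e φ π ι b) (h' : IsSliceChart l f j e' φ' π' ι' b') :
    ContDiffOn ℝ ∞ (e.symm ≫ₕ e') (e.symm ≫ₕ e').source := by
  rw [← contMDiffOn_iff_contDiffOn]
  have h1 : ContMDiffOn (𝓡 n) (𝓡 m) ∞ (fun z => b + ι z) (e.symm ≫ₕ e').source :=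
    (contMDiff_iff_contDiff.2 (by fun_prop)).contMDiffOn
  have hz : ∀ z ∈ (e.symm ≫ₕ e').source, b + ι z ∈ φ.target ∧
      φ.symm (b + ι z) = j (e.symm z) ∧ e.symm z ∈ e'.source := by
    intro z hz
    simp only [OpenPartialHomeomorph.trans_source, OpenPartialHomeomorph.symm_source,
      mem_inter_iff, mem_preimage] at hz
    have h2 := e.map_target hz.1
    have h3 := h.chart_eq _ h2
    rw [e.right_inv hz.1] at h3
    rw [← h3]
    exact ⟨φ.map_source (h.map_source _ h2), φ.left_inv (h.map_source _ h2), hz.2⟩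
  have h2 := (contMDiffOn_symm_of_mem_maximalAtlas h.mem).comp h1 fun z hz' => (hz z hz').1
  have h3 := (contMDiffOn_of_mem_maximalAtlas h'.mem).comp h2 fun z hz' => by
    change φ.symm (b + ι z) ∈ φ'.source
    rw [(hz z hz').2.1]
    exact h'.map_source _ (hz z hz').2.2
  have h4 := (contMDiff_iff_contDiff.2 π'.contDiff).comp_contMDiffOn h3
  refine h4.congr fun z hz' => ?_
  change e' (e.symm z) = π' (φ' (φ.symm (b + ι z)))
  rw [(hz z hz').2.1, h'.apply_eq _ (hz z hz').2.2]

theorem isManifold_slice [IsManifold (𝓡 m) ∞ G] [IsManifold (𝓡 l) ∞ L] (hW : IsOpen W)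
    (h : IsSubmersionOfComplement (EuclideanSpace ℝ (Fin n)) (𝓡 m) (𝓡 l) ∞ f) :
    let := sliceChartedSpace (y := y) hW h
    IsManifold (𝓡 n) ∞ {g : G // f g = y ∧ g ∈ W} := by
  let := sliceChartedSpace (y := y) hW h
  refine isManifold_of_contDiffOn _ _ _ ?_
  rintro _ _ ⟨x, rfl⟩ ⟨x', rfl⟩
  have := (isSliceChart_sliceChart hW x (h x)).contDiffOn_transition
    (isSliceChart_sliceChart hW x' (h x'))
  simpa using this

end

/-! ### Vector fields tangent to the fibres -/

section
variable {m l n : ℕ} {G : Type*} {L : Type*} [TopologicalSpace G]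
  [ChartedSpace (EuclideanSpace ℝ (Fin m)) G]
  [TopologicalSpace L] [ChartedSpace (EuclideanSpace ℝ (Fin l)) L]
  {f : G → L} {T : Type*} [TopologicalSpace T]
  {j : T → G} {e : OpenPartialHomeomorph T (EuclideanSpace ℝ (Fin n))}
  {φ : OpenPartialHomeomorph G (EuclideanSpace ℝ (Fin m))}
  {π : EuclideanSpace ℝ (Fin m) →L[ℝ] EuclideanSpace ℝ (Fin n)}
  {ι : EuclideanSpace ℝ (Fin n) →L[ℝ] EuclideanSpace ℝ (Fin m)}
  {b : EuclideanSpace ℝ (Fin m)}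

theorem chartField_apply (φ : OpenPartialHomeomorph G (EuclideanSpace ℝ (Fin m)))
    (V : ∀ g : G, TangentSpace (𝓡 m) g) {g : G} (hg : g ∈ φ.source) :
    chartField φ V (φ g) = mfderiv (𝓡 m) (𝓡 m) φ g (V g) := by
  unfold chartField
  rw [φ.left_inv hg]

/-- The expression in a slice chart of a vector field tangent to the fibres. -/
def sliceField (φ : OpenPartialHomeomorph G (EuclideanSpace ℝ (Fin m)))
    (π : EuclideanSpace ℝ (Fin m) →L[ℝ] EuclideanSpace ℝ (Fin n))
    (ι : EuclideanSpace ℝ (Fin n) →L[ℝ] EuclideanSpace ℝ (Fin m))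
    (b : EuclideanSpace ℝ (Fin m)) (V : ∀ g : G, TangentSpace (𝓡 m) g)
    (z : EuclideanSpace ℝ (Fin n)) : EuclideanSpace ℝ (Fin n) :=
  π (chartField φ V (b + ι z))

namespace IsSliceChart
theorem contMDiffOn [ChartedSpace (EuclideanSpace ℝ (Fin n)) T]
    (h : IsSliceChart l f j e φ π ι b) (he : e ∈ IsManifold.maximalAtlas (𝓡 n) ∞ T) :
    ContMDiffOn (𝓡 n) (𝓡 m) ∞ j e.source := by
  have h1 : ContMDiffOn (𝓡 n) (𝓡 m) ∞ (fun q => b + ι (e q)) e.source :=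
    (contMDiff_iff_contDiff.2 (show ContDiff ℝ ∞ fun z => b + ι z by fun_prop)).comp_contMDiffOn
      (contMDiffOn_of_mem_maximalAtlas he)
  refine ((contMDiffOn_symm_of_mem_maximalAtlas h.mem).comp h1 fun q hq => ?_).congr fun q hq => ?_
  · rw [mem_preimage, ← h.chart_eq q hq]
    exact φ.map_source (h.map_source q hq)
  · rw [Function.comp_apply, ← h.chart_eq q hq, φ.left_inv (h.map_source q hq)]

theorem chart_mfderiv [ChartedSpace (EuclideanSpace ℝ (Fin n)) T]
    (h : IsSliceChart l f j e φ π ι b)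
    (he : e ∈ IsManifold.maximalAtlas (𝓡 n) ∞ T) {q : T} (hq : q ∈ e.source)
    (v : TangentSpace (𝓡 n) q) :
    mfderiv (𝓡 m) (𝓡 m) φ (j q) (mfderiv (𝓡 n) (𝓡 m) j q v) =
      ι (mfderiv (𝓡 n) (𝓡 n) e q v) := by
  have h1 := HasMFDerivAt.comp q
    ((mdifferentiable_of_mem_maximalAtlas h.mem).mdifferentiableAt
      (h.map_source q hq)).hasMFDerivAt
    (((h.contMDiffOn he).contMDiffAt (e.open_source.mem_nhds hq)).mdifferentiableAt
      (by simp)).hasMFDerivAt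
  have h2 : HasMFDerivAt (𝓡 n) (𝓡 m) (φ ∘ j) q (ι.comp (mfderiv (𝓡 n) (𝓡 n) e q)) := by
    refine HasMFDerivAt.congr_of_eventuallyEq (HasMFDerivAt.comp q
      ((ι.hasFDerivAt (x := e q)).const_add b).hasMFDerivAt
      ((mdifferentiable_of_mem_maximalAtlas he).mdifferentiableAt hq).hasMFDerivAt) ?_
    filter_upwards [e.open_source.mem_nhds hq] with p hp
    exact h.chart_eq p hp
  exact DFunLike.congr_fun (hasMFDerivAt_unique h1 h2) v

theorem mem_target (h : IsSliceChart l f j e φ π ι b) {z : EuclideanSpace ℝ (Fin n)}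
    (hz : z ∈ e.target) : b + ι z ∈ φ.target := by
  have h1 := h.chart_eq _ (e.map_target hz)
  rw [e.right_inv hz] at h1
  rw [← h1]
  exact φ.map_source (h.map_source _ (e.map_target hz))

theorem contDiffOn_sliceField [IsManifold (𝓡 m) ∞ G]
    (h : IsSliceChart l f j e φ π ι b)
    {V : ∀ g : G, TangentSpace (𝓡 m) g} (hV : SmoothField V) :
    ContDiffOn ℝ ∞ (sliceField φ π ι b V) e.target :=
  π.contDiff.comp_contDiffOn ((contDiffOn_chartField h.mem hV).comp
    (show ContDiff ℝ ∞ fun z => b + ι z by fun_prop).contDiffOn fun _ hz => h.mem_target hz)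

theorem sliceField_apply (h : IsSliceChart l f j e φ π ι b)
    (V : ∀ g : G, TangentSpace (𝓡 m) g) {q : T} (hq : q ∈ e.source) :
    sliceField φ π ι b V (e q) = π (mfderiv (𝓡 m) (𝓡 m) φ (j q) (V (j q))) := by
  rw [sliceField, ← h.chart_eq q hq, chartField_apply φ V (h.map_source q hq)]

theorem incl_sliceField (h : IsSliceChart l f j e φ π ι b)
    {V : ∀ g : G, TangentSpace (𝓡 m) g} (hV : ∀ g, mfderiv (𝓡 m) (𝓡 l) f g (V g) = 0)
    {z : EuclideanSpace ℝ (Fin n)} (hz : z ∈ e.target) :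
    ι (sliceField φ π ι b V z) = chartField φ V (b + ι z) := by
  have hq := e.map_target hz
  have h1 := h.chart_eq _ hq
  have h2 := h.sliceField_apply V hq
  have h3 := chartField_apply φ V (h.map_source _ hq)
  rw [h1, e.right_inv hz] at h3
  rw [e.right_inv hz] at h2
  rw [h2, h3]
  exact h.incl_proj _ hq _ (hV _)

/-- Along the slice the chart expressions of vertical fields lie in the image of `ι`, so the
derivatives occurring in the ambient bracket are derivatives along the slice, and `π` passes through
them. -/
theorem lieBracket_sliceField [IsManifold (𝓡 m) ∞ G]
    (h : IsSliceChart l f j e φ π ι b)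
    {V W : ∀ g : G, TangentSpace (𝓡 m) g} (hVs : SmoothField V) (hWs : SmoothField W)
    (hV : ∀ g, mfderiv (𝓡 m) (𝓡 l) f g (V g) = 0)
    (hW : ∀ g, mfderiv (𝓡 m) (𝓡 l) f g (W g) = 0) {q : T} (hq : q ∈ e.source) :
    VectorField.lieBracket ℝ (sliceField φ π ι b V) (sliceField φ π ι b W) (e q) =
      π (mfderiv (𝓡 m) (𝓡 m) φ (j q) (VectorField.mlieBracket (𝓡 m) V W (j q))) := by
  have hz := e.map_source hq
  have key : ∀ Z : (∀ g : G, TangentSpace (𝓡 m) g), SmoothField Z → ∀ v,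
      fderiv ℝ (sliceField φ π ι b Z) (e q) v =
        π (fderiv ℝ (chartField φ Z) (b + ι (e q)) (ι v)) := by
    intro Z hZ v
    have h1 : HasFDerivAt (chartField φ Z) (fderiv ℝ (chartField φ Z) (b + ι (e q)))
        (b + ι (e q)) :=
      (((contDiffOn_chartField h.mem hZ).contDiffAt (φ.open_target.mem_nhds
        (h.mem_target hz))).differentiableAt (by simp)).hasFDerivAt
    have h2 : HasFDerivAt (sliceField φ π ι b Z) _ (e q) :=
      π.hasFDerivAt.comp (e q) (HasFDerivAt.comp (g := chartField φ Z) (f := fun z => b + ι z)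
        (e q) h1 ((ι.hasFDerivAt (x := e q)).const_add b))
    rw [h2.fderiv]
    rfl
  rw [mfderiv_mlieBracket h.mem hVs hWs (h.map_source q hq), VectorField.lieBracket, key W hWs,
    key V hVs, h.incl_sliceField hV hz, h.incl_sliceField hW hz, VectorField.lieBracket,
    h.chart_eq q hq, map_sub]

variable {R : Fin n → ∀ g : G, TangentSpace (𝓡 m) g}

theorem frameMap_sliceField (h : IsSliceChart l f j e φ π ι b) {q : T} (hq : q ∈ e.source)
    (a : Fin n → ℝ) : frameMap (fun i => sliceField φ π ι b (R i) (e q)) a =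
      π (mfderiv (𝓡 m) (𝓡 m) φ (j q) (∑ i, a i • R i (j q))) := by
  rw [frameMap_apply]
  simp only [h.sliceField_apply _ hq, map_sum, map_smul]
  exact (map_sum π _ _).symm ▸ Finset.sum_congr rfl fun i _ => (map_smul π (a i) _).symm

/-- Projection by `π` loses nothing on vertical vectors, so independence survives, and `n`
independent vectors form a basis of the `n`-dimensional model space. -/
theorem isInvertible_frameMap (h : IsSliceChart l f j e φ π ι b)
    (hR : ∀ i g, mfderiv (𝓡 m) (𝓡 l) f g (R i g) = 0) {q : T} (hq : q ∈ e.source)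
    (hinj : ∀ a : Fin n → ℝ, ∑ i, a i • R i (j q) = 0 → a = 0) :
    (frameMap fun i => sliceField φ π ι b (R i) (e q)).IsInvertible := by
  set A := frameMap fun i => sliceField φ π ι b (R i) (e q) with hA
  have h0 : Function.Injective A := by
    refine (injective_iff_map_eq_zero A).2 fun a ha => hinj a ?_
    rw [hA, h.frameMap_sliceField hq] at ha
    have h1 := h.incl_proj q hq (∑ i, a i • R i (j q)) (by
      rw [map_sum]
      refine Finset.sum_eq_zero fun i _ => ?_
      rw [map_smul, hR, smul_zero])
    rw [ha, map_zero] at h1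
    exact (map_eq_zero_iff _ ((mdifferentiable_of_mem_maximalAtlas h.mem).mfderiv_injective
      (h.map_source q hq))).1 h1.symm
  have h1 : Function.Bijective A.toLinearMap :=
    ⟨h0, (LinearMap.injective_iff_surjective_of_finrank_eq_finrank (by simp)).1 h0⟩
  exact ⟨(LinearEquiv.ofBijective A.toLinearMap h1).toContinuousLinearEquiv, by ext; rfl⟩

/-- The defining equation of the coframe on the fibre, in a slice chart. -/
theorem sum_smul_eq_iff [ChartedSpace (EuclideanSpace ℝ (Fin n)) T]
    (h : IsSliceChart l f j e φ π ι b)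
    (he : e ∈ IsManifold.maximalAtlas (𝓡 n) ∞ T)
    (hR : ∀ i g, mfderiv (𝓡 m) (𝓡 l) f g (R i g) = 0) {q : T} (hq : q ∈ e.source)
    (hinj : ∀ a : Fin n → ℝ, ∑ i, a i • R i (j q) = 0 → a = 0) (a : Fin n → ℝ)
    (v : TangentSpace (𝓡 n) q) :
    ∑ i, a i • R i (j q) = mfderiv (𝓡 n) (𝓡 m) j q v ↔
      a = (frameMap fun i => sliceField φ π ι b (R i) (e q)).inverse
        (mfderiv (𝓡 n) (𝓡 n) e q v) := by
  obtain ⟨A, hA⟩ := h.isInvertible_frameMap hR hq hinj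
  have h1 := h.frameMap_sliceField (R := R) hq a
  rw [← hA] at h1
  rw [← hA, ContinuousLinearMap.inverse_equiv]
  have h2 := h.chart_mfderiv he hq v
  have h3 : a = A.symm (mfderiv (𝓡 n) (𝓡 n) e q v) ↔ A a = mfderiv (𝓡 n) (𝓡 n) e q v :=
    A.toEquiv.eq_symm_apply
  refine Iff.trans ?_ h3.symm
  constructor
  · intro h4
    rw [h4, h2] at h1
    exact h1.trans (h.proj_incl _)
  · intro h4
    refine (mdifferentiable_of_mem_maximalAtlas h.mem).mfderiv_injective (h.map_source q hq) ?_
    rw [h2, ← h4]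
    refine Eq.trans ?_ (congrArg ι h1.symm)
    refine (h.incl_proj q hq _ ?_).symm
    rw [map_sum]
    refine Finset.sum_eq_zero fun i _ => ?_
    rw [map_smul, hR, smul_zero]

end IsSliceChart
end

namespace Data
variable {n d : ℕ} {X : Type u} [TopologicalSpace X]
  [ChartedSpace (EuclideanSpace ℝ (Fin d)) X] [IsManifold (𝓡 d) ∞ X] {D : Data n d X}

/-- A frame along the fibres of a map gives a realization on (an open part of) a fibre. -/
theorem exists_realization_of_slices {m l : ℕ} {G : Type*} {L : Type*} [TopologicalSpace G]
    [ChartedSpace (EuclideanSpace ℝ (Fin m)) G] [IsManifold (𝓡 m) ∞ G]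
    [TopologicalSpace L] [ChartedSpace (EuclideanSpace ℝ (Fin l)) L] {f : G → L}
    {T : Type*} [TopologicalSpace T] [ChartedSpace (EuclideanSpace ℝ (Fin n)) T]
    [IsManifold (𝓡 n) ∞ T] {j : T → G}
    (hsl : ∀ p : T, ∃ e ∈ IsManifold.maximalAtlas (𝓡 n) ∞ T, p ∈ e.source ∧
      ∃ φ π ι b, IsSliceChart (m := m) l f j e φ π ι b)
    {R : Fin n → ∀ g : G, TangentSpace (𝓡 m) g} (hRs : ∀ i, SmoothField (R i))
    (hR : ∀ i g, mfderiv (𝓡 m) (𝓡 l) f g (R i g) = 0)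
    (hinj : ∀ (p : T) (a : Fin n → ℝ), ∑ i, a i • R i (j p) = 0 → a = 0)
    {k : G → X} (hk : ContMDiff (𝓡 m) (𝓡 d) ∞ k)
    (hkR : ∀ i g, mfderiv (𝓡 m) (𝓡 d) k g (R i g) = D.F i (k g))
    (hC : ∀ i j k x, D.C i j k x = -D.C j i k x)
    (hbr : ∀ i j g, VectorField.mlieBracket (𝓡 m) (R i) (R j) g =
      -∑ c, D.C i j c (k g) • R c g) :
    ∃ ℛ : D.Realization T, ∀ p, ℛ.h p = k (j p) := by
  choose e he hpe φ π ι b hs using hsl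
  have hj : ContMDiff (𝓡 n) (𝓡 m) ∞ j := fun p =>
    ((hs p).contMDiffOn (he p)).contMDiffAt ((e p).open_source.mem_nhds (hpe p))
  set A : T → EuclideanSpace ℝ (Fin n) → (Fin n → ℝ) →L[ℝ] EuclideanSpace ℝ (Fin n) :=
    fun p z => frameMap fun i => sliceField (φ p) (π p) (ι p) (b p) (R i) z with hA
  have hAinv : ∀ p, ∀ z ∈ (e p).target, (A p z).IsInvertible := by
    intro p z hz
    have := (hs p).isInvertible_frameMap hR ((e p).map_target hz) (hinj _)
    rwa [(e p).right_inv hz] at this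
  set θ : ∀ p : T, TangentSpace (𝓡 n) p →L[ℝ] (Fin n → ℝ) := fun p =>
    (A p (e p p)).inverse.comp (mfderiv (𝓡 n) (𝓡 n) (e p) p) with hθ
  -- The form is defined with a separate chart at each point. This identity characterizes it without
  -- charts, as the coefficients of `dj v` in the frame `R`, and so gives its expression at every
  -- point of any of the chosen charts.
  have hθj : ∀ p v, ∑ i, θ p v i • R i (j p) = mfderiv (𝓡 n) (𝓡 m) j p v := fun p v =>
    ((hs p).sum_smul_eq_iff (he p) hR (hpe p) (hinj p) _ v).2 rfl
  refine ⟨Realization.ofCharts θ (k ∘ j) (hk.comp hj) (fun p => ?_) (fun p v => ?_)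
    fun p => ⟨e p, he p, hpe p, fun z => (A p z).inverse, ?_, ?_, ?_⟩, fun p => rfl⟩
  · obtain ⟨e', he'⟩ := hAinv p _ ((e p).map_source (hpe p))
    have h1 : Function.Bijective (A p (e p p)).inverse := by
      rw [← he', ContinuousLinearMap.inverse_equiv]
      exact e'.symm.bijective
    exact h1.comp ((mdifferentiable_of_mem_maximalAtlas (he p)).mfderiv_bijective (hpe p))
  · have h1 := HasMFDerivAt.comp p (hk.mdifferentiableAt (by simp) (x := j p)).hasMFDerivAt
      (hj.mdifferentiableAt (by simp) (x := p)).hasMFDerivAt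
    rw [h1.mfderiv]
    change mfderiv (𝓡 m) (𝓡 d) k (j p) (mfderiv (𝓡 n) (𝓡 m) j p v) = _
    rw [← hθj, map_sum]
    refine Finset.sum_congr rfl fun i _ => ?_
    rw [map_smul, hkR]
    rfl
  · exact contDiffOn_inverse_frameMap (fun i => (hs p).contDiffOn_sliceField (hRs i)) (hAinv p)
  · exact fun q hq v =>
      ((hs p).sum_smul_eq_iff (he p) hR hq (hinj q) _ v).1 (hθj q v)
  · intro z hz
    refine curlEq_inverse_frameMap (e p).open_target
      (fun i => (hs p).contDiffOn_sliceField (hRs i)) (hAinv p) (fun i j k => hC i j k _) hz ?_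
    intro i i'
    have hq := (e p).map_target hz
    have h1 := (hs p).lieBracket_sliceField (hRs i) (hRs i') (hR i) (hR i') hq
    have h2 := (hs p).frameMap_sliceField (R := R) hq
      (fun c => -D.C i i' c (k (j ((e p).symm z))))
    have h3 : ∑ c, -D.C i i' c (k (j ((e p).symm z))) • R c (j ((e p).symm z)) =
        VectorField.mlieBracket (𝓡 m) (R i) (R i') (j ((e p).symm z)) := by
      rw [hbr, ← Finset.sum_neg_distrib]
      exact Finset.sum_congr rfl fun c _ => neg_smul _ _
    rw [h3, ← h1, frameMap_apply, (e p).right_inv hz] at h2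
    rw [← h2, ← Finset.sum_neg_distrib]
    exact Finset.sum_congr rfl fun c _ => neg_smul _ _

end Data

/-! ### Structure functions, and propagation along `A`-paths -/

namespace Data
variable {n d : ℕ} {X : Type u} [TopologicalSpace X]
  [ChartedSpace (EuclideanSpace ℝ (Fin d)) X] [IsManifold (𝓡 d) ∞ X] {D : Data n d X}

theorem bracket_const (a b : Fin n → ℝ) (x : X) (k : Fin n) :
    D.bracket (fun _ => a) (fun _ => b) x k = -∑ i, ∑ j, D.C i j k x * a i * b j := by
  simp [bracket, mvfderiv]

theorem bracket_single (i j : Fin n) (x : X) (k : Fin n) :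
    D.bracket (fun _ => Pi.single i 1) (fun _ => Pi.single j 1) x k = -D.C i j k x := by
  rw [bracket_const]
  simp [Pi.single_apply]

/-- Skew symmetry of the bracket on the constant sections `e_i`, `e_j`, where the derivative terms
vanish. -/
theorem IsLieAlgebroid.C_antisymm (hA : D.IsLieAlgebroid) (i j k : Fin n) (x : X) :
    D.C i j k x = -D.C j i k x := by
  have h := congrFun (congrFun (hA.skew _ _ 
    (contMDiff_const (c := Pi.single i (1 : ℝ))) (contMDiff_const (c := Pi.single j (1 : ℝ)))) x) k
  rw [Pi.neg_apply, Pi.neg_apply, bracket_single, bracket_single] at h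
  linarith

/-- A piece of an `A`-path is an `A`-path. -/
theorem aPathJoined_of_mem_Icc {γ : ℝ → X} {a : ℝ → Fin n → ℝ}
    (hγ : ContMDiffOn 𝓘(ℝ, ℝ) (𝓡 d) ∞ γ (Icc 0 1)) (ha : ContDiffOn ℝ ∞ a (Icc 0 1))
    (h : D.IsAnchored γ a 0 1) {τ : ℝ} (hτ : τ ∈ Icc (0 : ℝ) 1) :
    D.APathJoined (γ 0) (γ τ) := by
  have hmaps : MapsTo (fun t => t * τ) (Icc (0 : ℝ) 1) (Icc 0 1) := fun t ht =>
    ⟨mul_nonneg ht.1 hτ.1, mul_le_one₀ ht.2 hτ.1 hτ.2⟩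
  have hs : ContDiff ℝ ∞ fun t : ℝ => t * τ := by fun_prop
  refine ⟨fun t => γ (t * τ), fun t => τ • a (t * τ), hγ.comp (contMDiff_iff_contDiff.2 hs).contMDiffOn
    hmaps, (ha.comp hs.contDiffOn hmaps).const_smul τ, by simp, by simp, fun t ht => ?_⟩
  have h1 : HasMFDerivWithinAt 𝓘(ℝ, ℝ) 𝓘(ℝ, ℝ) (fun t => t * τ) (Icc 0 1) t
      ((1 : ℝ →L[ℝ] ℝ).smulRight τ) := by
    have := ((hasDerivWithinAt_id t (Icc (0 : ℝ) 1)).mul_const τ).hasFDerivWithinAt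
    rw [_root_.one_mul] at this
    exact this.hasMFDerivWithinAt
  have h2 := HasMFDerivWithinAt.comp t (h _ (hmaps ht)) h1 hmaps
  have h3 : D.anchor (γ (t * τ)) (τ • a (t * τ)) = τ • D.anchor (γ (t * τ)) (a (t * τ)) := by
    simp [anchor, Finset.smul_sum, smul_smul]
  rw [h3]
  set v := D.anchor (γ (t * τ)) (a (t * τ))
  refine HasMFDerivWithinAt.congr_mfderiv h2 ?_
  refine ContinuousLinearMap.ext_ring ?_
  change ((1 : ℝ) * τ) • v = (1 : ℝ) • τ • v
  rw [_root_.one_mul, one_smul]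

/-- If the orbit through `x₀` is partitioned by the ranges of realizations, it is one of them. -/
theorem eq_of_sameOrbit {x₀ : X} {O : X → Set X} (h_self : ∀ x ∈ D.orbit x₀, x ∈ O x)
    (h_eq : ∀ x ∈ D.orbit x₀, ∀ x' ∈ D.orbit x₀, ∀ z ∈ O x, z ∈ O x' → O x = O x')
    (h_range : ∀ x ∈ D.orbit x₀, ∃ (M : Type u) (_ : TopologicalSpace M)
      (_ : ChartedSpace (EuclideanSpace ℝ (Fin n)) M) (_ : IsManifold (𝓡 n) ∞ M)
      (R : D.Realization M), range R.h = O x) {x x' : X} (hx : x ∈ D.orbit x₀)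
    (h : D.SameOrbit x x') : O x = O x' := by
  induction h with
  | refl => rfl
  | symm x x' h ih =>
    exact (ih (Relation.EqvGen.trans _ _ _ hx (Relation.EqvGen.symm _ _ h))).symm
  | trans x x' x'' h h' ih ih' =>
    exact (ih hx).trans (ih' (Relation.EqvGen.trans _ _ _ hx h))
  | rel x x' h =>
    obtain ⟨γ, a, hγ, ha, rfl, rfl, hγa⟩ := h
    have horb : ∀ t ∈ Icc (0 : ℝ) 1, γ t ∈ D.orbit x₀ := fun t ht =>
      Relation.EqvGen.trans _ _ _ hx
        (Relation.EqvGen.rel _ _ (aPathJoined_of_mem_Icc hγ ha hγa ht))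
    -- The class `O (γ t)` is locally constant: the path stays for a short time in the range of the
    -- realization through `γ t`, which is the set `O (γ t)`. Connectedness of the interval makes it
    -- constant.
    refine isPreconnected_Icc.induction₂ (fun t t' => O (γ t) = O (γ t')) (fun t ht => ?_)
      (fun _ _ _ _ _ _ h h' => h.trans h') (fun _ _ _ _ h => h.symm)
      (left_mem_Icc.2 zero_le_one) (right_mem_Icc.2 zero_le_one)
    obtain ⟨M, _, _, _, R, hR⟩ := h_range _ (horb t ht)
    obtain ⟨p, hp⟩ := hR.symm ▸ h_self _ (horb t ht)
    filter_upwards [R.eventually_mem_range_h ha.continuousOn hγa ht hp,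
      self_mem_nhdsWithin] with t' ht' hmem
    rw [hR] at ht'
    exact h_eq _ (horb t ht) _ (horb t' hmem) _ ht' (h_self _ (horb t' hmem))

end Data

/-! ### Source fibres of a Lie groupoid -/

namespace LieGroupoid
variable {m l n : ℕ} {G L : Type u}
    [TopologicalSpace G] [ChartedSpace (EuclideanSpace ℝ (Fin m)) G] [IsManifold (𝓡 m) ∞ G]
    [TopologicalSpace L] [ChartedSpace (EuclideanSpace ℝ (Fin l)) L] [IsManifold (𝓡 l) ∞ L]
    (𝒢 : LieGroupoid m l G L)

variable {𝒢} in
/-- A family of right invariant vector fields which is independent along the units is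
independent everywhere. -/
theorem IsRightInvariant.eq_zero_of_sum_smul_eq_zero {R : Fin n → ∀ g : G, TangentSpace (𝓡 m) g}
    (hR : ∀ i, 𝒢.IsRightInvariant (R i)) {g : G} {a : Fin n → ℝ}
    (hone : ∑ i, a i • R i (𝒢.one (𝒢.t g)) = 0 → a = 0) (ha : ∑ i, a i • R i g = 0) : a = 0 := by
  apply hone
  have hg : 𝒢.s g = 𝒢.t (𝒢.inv g) := (𝒢.t_inv g).symm
  -- Right translation by the inverse of `g` carries the relation from `g` to the unit at `t g`.
  have h1 : ∑ i, a i • R i (𝒢.mul g (𝒢.inv g)) = 0 := by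
    simp only [fun i => (hR i).invariant g (𝒢.inv g) hg, ← map_smul, ← map_sum]
    rw [ha, map_zero]
  rwa [𝒢.mul_inv g] at h1

/-- The source fibres have the dimension of the frame of right invariant vector fields. -/
theorem isSubmersionOfComplement_s {R : Fin n → ∀ g : G, TangentSpace (𝓡 m) g}
    (hR : ∀ i, 𝒢.IsRightInvariant (R i)) (y : L)
    (hone : ∀ v : TangentSpace (𝓡 m) (𝒢.one y), mfderiv (𝓡 m) (𝓡 l) 𝒢.s (𝒢.one y) v = 0 →
      ∃! a : Fin n → ℝ, ∑ i, a i • R i (𝒢.one y) = v) :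
    IsSubmersionOfComplement (EuclideanSpace ℝ (Fin n)) (𝓡 m) (𝓡 l) ∞ 𝒢.s := by
  obtain ⟨F, _, _, hc⟩ := 𝒢.submersion_s
  have h := hc (𝒢.one y)
  set g := 𝒢.one y
  have hg : g ∈ h.domChart.source := h.mem_domChart_source
  have hφ := mdifferentiable_of_mem_maximalAtlas h.domChart_mem_maximalAtlas
  -- The complement `F` in the submersion charts is one space for all of `G`. At the single unit
  -- `one y` it is identified with the kernel of `ds`, of which the `R i` are a basis; so `F` can be
  -- replaced by `ℝⁿ` everywhere.
  set Φ : (Fin n → ℝ) →ₗ[ℝ] F := (LinearMap.snd ℝ (EuclideanSpace ℝ (Fin l)) F) ∘ₗ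
    h.equiv.toLinearEquiv.toLinearMap ∘ₗ
    (mfderiv (𝓡 m) (𝓡 m) h.domChart g).toLinearMap ∘ₗ
    Fintype.linearCombination ℝ (fun i => R i g) with hΦ
  have hΦa : ∀ a, Φ a = (h.equiv (mfderiv (𝓡 m) (𝓡 m) h.domChart g (∑ i, a i • R i g))).2 :=
    fun a => rfl
  have hker : ∀ a : Fin n → ℝ, mfderiv (𝓡 m) (𝓡 l) 𝒢.s g (∑ i, a i • R i g) = 0 := by
    intro a
    rw [map_sum]
    refine Finset.sum_eq_zero fun i _ => ?_
    rw [map_smul, (hR i).tangent, smul_zero]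
  have hbij : Function.Bijective Φ := by
    constructor
    · refine (injective_iff_map_eq_zero Φ).2 fun a ha => ?_
      rw [hΦa] at ha
      have h1 := (mfderiv_eq_zero_iff h hg _).1 (hker a)
      have h2 := (map_eq_zero_iff _ h.equiv.injective).1 (Prod.ext h1 ha)
      have h3 := (map_eq_zero_iff _ (hφ.mfderiv_injective hg)).1 h2
      exact (hone 0 (map_zero _)).unique h3 (by simp)
    · intro w
      obtain ⟨v, hv⟩ := hφ.mfderiv_surjective hg (h.equiv.symm (0, w))
      have h1 : h.equiv (mfderiv (𝓡 m) (𝓡 m) h.domChart g v) = (0, w) := by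
        rw [hv]
        exact h.equiv.apply_symm_apply _
      obtain ⟨a, ha, -⟩ := hone v ((mfderiv_eq_zero_iff h hg v).2 (by rw [h1]))
      refine ⟨a, ?_⟩
      rw [hΦa]
      rw [ha, h1]
  set E := LinearEquiv.ofBijective Φ hbij
  have : FiniteDimensional ℝ F := E.finiteDimensional
  exact hc.trans_F (E.toContinuousLinearEquiv.symm.trans (EuclideanSpace.equiv (Fin n) ℝ).symm)

/-- The connected component of the unit at `y` in its source fibre. -/
def unitComponent (y : L) : Set G := connectedComponentIn {g | 𝒢.s g = y} (𝒢.one y)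

theorem one_mem_unitComponent (y : L) : 𝒢.one y ∈ 𝒢.unitComponent y :=
  mem_connectedComponentIn (𝒢.s_one y)

theorem s_eq_of_mem_unitComponent {y : L} {g : G} (hg : g ∈ 𝒢.unitComponent y) : 𝒢.s g = y :=
  connectedComponentIn_subset {g | 𝒢.s g = y} _ hg

/-- Right translation by `k = g⁻¹ g'` maps the source fibre over `y` continuously to that over `y'`,
takes `g` to `g'` and preserves targets. The image of the first component is connected and contains
`g'`, so it lies in the second. -/
theorem image_t_unitComponent_subset {y y' : L} {g g' : G} (hg : g ∈ 𝒢.unitComponent y)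
    (hg' : g' ∈ 𝒢.unitComponent y') (h : 𝒢.t g = 𝒢.t g') :
    𝒢.t '' 𝒢.unitComponent y ⊆ 𝒢.t '' 𝒢.unitComponent y' := by
  have hs := 𝒢.s_eq_of_mem_unitComponent hg
  have hs' := 𝒢.s_eq_of_mem_unitComponent hg'
  have h1 : 𝒢.s (𝒢.inv g) = 𝒢.t g' := (𝒢.s_inv g).trans h
  set k := 𝒢.mul (𝒢.inv g) g' with hk
  have htk : 𝒢.t k = y := by rw [hk, 𝒢.t_mul _ _ h1, 𝒢.t_inv, hs]
  have hsk : 𝒢.s k = y' := by rw [hk, 𝒢.s_mul _ _ h1, hs']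
  have hgk : 𝒢.mul g k = g' := by
    rw [hk, ← 𝒢.mul_assoc _ _ _ (𝒢.t_inv g).symm h1, 𝒢.mul_inv, h, 𝒢.one_mul]
  have hcont : ContinuousOn (fun p => 𝒢.mul p k) {p | 𝒢.s p = y} :=
    𝒢.smooth_mul.continuousOn.comp (f := fun p => (p, k)) (by fun_prop)
      fun p hp => Eq.trans hp htk.symm
  have hsub : (fun p => 𝒢.mul p k) '' 𝒢.unitComponent y ⊆ 𝒢.unitComponent y' := by
    have h2 : 𝒢.unitComponent y' = connectedComponentIn {p | 𝒢.s p = y'} g' :=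
      connectedComponentIn_eq hg'
    rw [h2]
    refine (isPreconnected_connectedComponentIn.image _
      (hcont.mono (connectedComponentIn_subset _ _))).subset_connectedComponentIn ⟨g, hg, hgk⟩ ?_
    rintro _ ⟨p, hp, rfl⟩
    have h3 := 𝒢.s_eq_of_mem_unitComponent hp
    exact (𝒢.s_mul p k (h3.trans htk.symm)).trans hsk
  rintro _ ⟨p, hp, rfl⟩
  exact ⟨𝒢.mul p k, hsub ⟨p, hp, rfl⟩,
    𝒢.t_mul p k ((𝒢.s_eq_of_mem_unitComponent hp).trans htk.symm)⟩

theorem image_t_unitComponent_eq {y y' : L} {g g' : G} (hg : g ∈ 𝒢.unitComponent y)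
    (hg' : g' ∈ 𝒢.unitComponent y') (h : 𝒢.t g = 𝒢.t g') :
    𝒢.t '' 𝒢.unitComponent y = 𝒢.t '' 𝒢.unitComponent y' :=
  (𝒢.image_t_unitComponent_subset hg hg' h).antisymm
    (𝒢.image_t_unitComponent_subset hg' hg h.symm)

/-- The unit component is open in its source fibre. -/
theorem exists_isOpen_unitComponent
    (h : IsSubmersionOfComplement (EuclideanSpace ℝ (Fin n)) (𝓡 m) (𝓡 l) ∞ 𝒢.s) (y : L) :
    ∃ W : Set G, IsOpen W ∧ 𝒢.unitComponent y = {g | 𝒢.s g = y ∧ g ∈ W} := by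
  -- The whole source fibre is a manifold, hence locally connected with open components. Writing the
  -- component as the fibre cut by an open `W` lets slice charts apply to it directly.
  let := sliceChartedSpace (y := y) isOpen_univ h
  have : LocallyConnectedSpace {g : G // 𝒢.s g = y ∧ g ∈ univ} :=
    ChartedSpace.locallyConnectedSpace (EuclideanSpace ℝ (Fin n)) _
  have hF : {g : G | 𝒢.s g = y} = {g : G | 𝒢.s g = y ∧ g ∈ univ} := by ext; simp
  have h1 := isOpen_connectedComponent (x := (⟨𝒢.one y, 𝒢.s_one y, mem_univ _⟩ :
    {g : G // 𝒢.s g = y ∧ g ∈ univ}))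
  obtain ⟨W, hW, hWe⟩ := isOpen_induced_iff.1 h1
  refine ⟨W, hW, ?_⟩
  rw [unitComponent, hF, connectedComponentIn_eq_image
    (F := {g : G | 𝒢.s g = y ∧ g ∈ univ}) ⟨𝒢.s_one y, mem_univ _⟩]
  refine (congrArg (image Subtype.val) hWe.symm).trans ?_
  ext g
  constructor
  · rintro ⟨p, hp, rfl⟩
    exact ⟨p.2.1, hp⟩
  · rintro ⟨hg, hgW⟩
    exact ⟨⟨g, hg, mem_univ g⟩, hgW, rfl⟩

end LieGroupoid

/-! ### Connected realizations from the groupoid -/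

namespace Data
variable {n d : ℕ} {X : Type u} [TopologicalSpace X]
  [ChartedSpace (EuclideanSpace ℝ (Fin d)) X] [IsManifold (𝓡 d) ∞ X] {D : Data n d X}

/-- The unit components of the source fibres carry connected realizations. -/
theorem IsRestriction.exists_realization_unitComponent (hA : D.IsLieAlgebroid) {m l : ℕ}
    {G L : Type u} [TopologicalSpace G] [SecondCountableTopology G]
    [ChartedSpace (EuclideanSpace ℝ (Fin m)) G] [IsManifold (𝓡 m) ∞ G] [TopologicalSpace L]
    [ChartedSpace (EuclideanSpace ℝ (Fin l)) L] [IsManifold (𝓡 l) ∞ L] {ι : L → X}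
    (hι : ContMDiff (𝓡 l) (𝓡 d) ∞ ι) {D' : Data n l L} (hD' : D.IsRestriction ι D')
    {𝒢 : LieGroupoid m l G L} (hint : 𝒢.Integrates D') (y : L) :
    ∃ (M : Type u) (_ : TopologicalSpace M) (_ : T2Space M) (_ : SecondCountableTopology M)
      (_ : ConnectedSpace M) (_ : ChartedSpace (EuclideanSpace ℝ (Fin n)) M)
      (_ : IsManifold (𝓡 n) ∞ M) (R : D.Realization M),
      range R.h = ι '' (𝒢.t '' 𝒢.unitComponent y) := by
  obtain ⟨R, hR, hone, hanchor, hbr⟩ := hint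
  have hsub := 𝒢.isSubmersionOfComplement_s (fun i => (hR i).2) y (hone y)
  obtain ⟨W, hW, hWe⟩ := 𝒢.exists_isOpen_unitComponent hsub y
  let := sliceChartedSpace (y := y) hW hsub
  have := isManifold_slice (y := y) hW hsub
  have hT2 : T2Space {g : G // 𝒢.s g = y ∧ g ∈ W} := by
    have := 𝒢.t2_fibre y
    refine T2Space.of_injective_continuous
      (f := fun g : {g : G // 𝒢.s g = y ∧ g ∈ W} => (⟨g, g.2.1⟩ : {g : G // 𝒢.s g = y}))
      (fun g g' h => Subtype.ext (show (g : G) = g' from congrArg (fun p : {g : G // 𝒢.s g = y} => (p : G)) h)) (by fun_prop)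
  have hconn : ConnectedSpace {g : G // 𝒢.s g = y ∧ g ∈ W} := by
    refine Subtype.connectedSpace (s := {g : G | 𝒢.s g = y ∧ g ∈ W}) ?_
    rw [← hWe]
    exact isConnected_connectedComponentIn_iff.2 (𝒢.s_one y)
  have htsm : ContMDiff (𝓡 m) (𝓡 l) ∞ 𝒢.t := 𝒢.submersion_t.contMDiff
  have hkR : ∀ i g, mfderiv (𝓡 m) (𝓡 d) (ι ∘ 𝒢.t) g (R i g) = D.F i ((ι ∘ 𝒢.t) g) := by
    intro i g
    have h1 := HasMFDerivAt.comp g (hι.mdifferentiableAt (by simp) (x := 𝒢.t g)).hasMFDerivAt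
      (htsm.mdifferentiableAt (by simp) (x := g)).hasMFDerivAt
    rw [h1.mfderiv]
    change mfderiv (𝓡 l) (𝓡 d) ι (𝒢.t g) (mfderiv (𝓡 m) (𝓡 l) 𝒢.t g (R i g)) = _
    rw [hanchor, hD'.F_related]
    rfl
  -- The bracket identity of the integration, on constant sections, where `∑ α^c R_c` is just `R i`.
  -- Its minus sign is the one that makes the dual coframe satisfy `dθ^k = ∑ C_{ij}^k θ^i ∧ θ^j`.
  have hkbr : ∀ i j g, VectorField.mlieBracket (𝓡 m) (R i) (R j) g =
      -∑ c, D.C i j c ((ι ∘ 𝒢.t) g) • R c g := by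
    intro i i' g
    have h1 := hbr _ _ (contMDiff_const (c := Pi.single i (1 : ℝ)))
      (contMDiff_const (c := Pi.single i' (1 : ℝ))) g
    simp only [bracket_single, hD'.C_eq] at h1
    have h2 : ∀ i : Fin n, (fun h => ∑ c, (Pi.single i (1 : ℝ) : Fin n → ℝ) c • R c h) = R i := by
      intro i
      funext h
      simp [Pi.single_apply]
    rw [h2, h2] at h1
    rw [h1, ← Finset.sum_neg_distrib]
    exact Finset.sum_congr rfl fun c _ => neg_smul _ _
  obtain ⟨ℛ, hℛ⟩ := exists_realization_of_slices (D := D)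
    (T := {g : G // 𝒢.s g = y ∧ g ∈ W}) (j := Subtype.val) (f := 𝒢.s) (R := R) (k := ι ∘ 𝒢.t)
    (fun p => ⟨chartAt _ p, IsManifold.chart_mem_maximalAtlas p, mem_chart_source _ p,
      _, _, _, _, isSliceChart_sliceChart hW p (hsub p)⟩)
    (fun i => (hR i).1) (fun i => (hR i).2.tangent)
    (fun p a => LieGroupoid.IsRightInvariant.eq_zero_of_sum_smul_eq_zero (fun i => (hR i).2)
      fun h => (hone _ 0 (map_zero _)).unique h (by simp))
    (hι.comp htsm) hkR hA.C_antisymm hkbr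
  refine ⟨{g : G // 𝒢.s g = y ∧ g ∈ W}, inferInstance, hT2,
    TopologicalSpace.Subtype.secondCountableTopology {g : G | 𝒢.s g = y ∧ g ∈ W}, hconn, inferInstance,
    inferInstance, ℛ, ?_⟩
  rw [hWe, image_image, ← Subtype.range_coe_subtype, ← range_comp]
  exact congrArg range (funext hℛ)

end Data

/-! ### One realization through two points of an orbit -/

namespace Data
variable {n d : ℕ} {X : Type u} [TopologicalSpace X]
  [ChartedSpace (EuclideanSpace ℝ (Fin d)) X] [IsManifold (𝓡 d) ∞ X] {D : Data n d X}

theorem Realization.SameGerm.h_eq {M₀ : Type v} [TopologicalSpace M₀]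
    [ChartedSpace (EuclideanSpace ℝ (Fin n)) M₀] [IsManifold (𝓡 n) ∞ M₀]
    {M : Type w} [TopologicalSpace M]
    [ChartedSpace (EuclideanSpace ℝ (Fin n)) M] [IsManifold (𝓡 n) ∞ M]
    {R₀ : D.Realization M₀} {m₀ : M₀} {R : D.Realization M} {p : M} (h : R₀.SameGerm m₀ R p) :
    R.h p = R₀.h m₀ := by
  obtain ⟨φ, -, -, hm, rfl, hφ⟩ := h
  exact (hφ m₀ hm).1

/-- Two points of one orbit of a weakly integrable algebroid lie in the range of one connected
realization. -/
theorem WeaklyIntegrable.exists_realization (hA : D.IsLieAlgebroid) (hW : D.WeaklyIntegrable)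
    {x₀ x₁ : X} (h : D.SameOrbit x₀ x₁) :
    ∃ (M : Type u) (_ : TopologicalSpace M) (_ : T2Space M) (_ : SecondCountableTopology M)
      (_ : ConnectedSpace M) (_ : ChartedSpace (EuclideanSpace ℝ (Fin n)) M)
      (_ : IsManifold (𝓡 n) ∞ M) (R : D.Realization M), x₀ ∈ range R.h ∧ x₁ ∈ range R.h := by
  obtain ⟨l, L, _, _, _, _, _, ι, D', hleaf, hD', m, G, _, _, _, _, 𝒢, hint⟩ := hW x₀
  have hR := fun y => hD'.exists_realization_unitComponent hA hleaf.immersion.contMDiff hint y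
  have hι : ∀ y, ι y ∈ D.orbit x₀ := fun y => hleaf.range_eq ▸ mem_range_self y
  have hex : ∀ x ∈ D.orbit x₀, ∃ y, ι y = x := fun x hx => by
    rw [← hleaf.range_eq] at hx
    exact hx
  have hself : ∀ y, ι y ∈ ι '' (𝒢.t '' 𝒢.unitComponent y) := fun y =>
    ⟨y, ⟨𝒢.one y, 𝒢.one_mem_unitComponent y, 𝒢.t_one y⟩, rfl⟩
  -- Transports the images of the unit components from `L` to subsets of `X` indexed by points of
  -- `X`. The union has a single term over a point of the orbit, because `ι` is injective.
  set O : X → Set X := fun x => ⋃ y ∈ ι ⁻¹' {x}, ι '' (𝒢.t '' 𝒢.unitComponent y) with hO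
  have hOι : ∀ y, O (ι y) = ι '' (𝒢.t '' 𝒢.unitComponent y) := by
    intro y
    simp [hO, hleaf.injective.eq_iff]
  have hx₀ : x₀ ∈ D.orbit x₀ := Relation.EqvGen.refl _
  have hOeq : O x₀ = O x₁ := by
    refine eq_of_sameOrbit ?_ ?_ ?_ hx₀ h
    · intro x hx
      obtain ⟨y, rfl⟩ := hex x hx
      exact hOι y ▸ hself y
    · intro x hx x' hx' z hz hz'
      obtain ⟨y, rfl⟩ := hex x hx
      obtain ⟨y', rfl⟩ := hex x' hx'
      rw [hOι] at hz hz' ⊢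
      rw [hOι]
      obtain ⟨_, ⟨g, hg, rfl⟩, rfl⟩ := hz
      obtain ⟨_, ⟨g', hg', rfl⟩, h'⟩ := hz'
      rw [𝒢.image_t_unitComponent_eq hg hg' (hleaf.injective h').symm]
    · intro x hx
      obtain ⟨y, rfl⟩ := hex x hx
      obtain ⟨M, i₁, -, -, -, i₂, i₃, R, hR⟩ := hR y
      exact ⟨M, i₁, i₂, i₃, R, hR.trans (hOι y).symm⟩
  obtain ⟨y₀, rfl⟩ := hex x₀ hx₀
  obtain ⟨y₁, rfl⟩ := hex x₁ h
  obtain ⟨M, i₁, i₂, i₃, i₄, i₅, i₆, R, hR⟩ := hR y₀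
  refine ⟨M, i₁, i₂, i₃, i₄, i₅, i₆, R, hR ▸ hself y₀, ?_⟩
  rw [hR, ← hOι, hOeq, hOι]
  exact hself y₁

end Data

end Cartan
end

theorem mainTheorem4 {n d : ℕ} {X : Type u} [TopologicalSpace X] [T2Space X]
    [SecondCountableTopology X] [ChartedSpace (EuclideanSpace ℝ (Fin d)) X]
    [IsManifold (𝓡 d) ∞ X] (D : Cartan.Data n d X)
    (hA : D.IsLieAlgebroid) (hW : D.WeaklyIntegrable)
    {M₀ : Type v} [TopologicalSpace M₀] [T2Space M₀] [SecondCountableTopology M₀]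
    [ChartedSpace (EuclideanSpace ℝ (Fin n)) M₀] [IsManifold (𝓡 n) ∞ M₀]
    {M₁ : Type w} [TopologicalSpace M₁] [T2Space M₁] [SecondCountableTopology M₁]
    [ChartedSpace (EuclideanSpace ℝ (Fin n)) M₁] [IsManifold (𝓡 n) ∞ M₁]
    (R₀ : D.Realization M₀) (m₀ : M₀) (R₁ : D.Realization M₁) (m₁ : M₁) :
    (∃ (M : Type u) (_ : TopologicalSpace M) (_ : T2Space M) (_ : SecondCountableTopology M)
      (_ : ConnectedSpace M) (_ : ChartedSpace (EuclideanSpace ℝ (Fin n)) M)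
      (_ : IsManifold (𝓡 n) ∞ M) (R : D.Realization M) (p₀ p₁ : M),
      R₀.SameGerm m₀ R p₀ ∧ R₁.SameGerm m₁ R p₁) ↔
    D.SameOrbit (R₀.h m₀) (R₁.h m₁) := by
  constructor
  · rintro ⟨M, _, _, _, _, _, _, R, p₀, p₁, h₀, h₁⟩
    rw [← h₀.h_eq, ← h₁.h_eq]
    exact R.sameOrbit p₀ p₁
  · intro h
    obtain ⟨M, i₁, i₂, i₃, i₄, i₅, i₆, R, ⟨p₀, hp₀⟩, ⟨p₁, hp₁⟩⟩ := hW.exists_realization hA h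
    -- The points `p₀` and `p₁` were chosen only by their values under `h`; local uniqueness
    -- upgrades this to equality of germs.
    exact ⟨M, i₁, i₂, i₃, i₄, i₅, i₆, R, p₀, p₁, R.sameGerm_of_h_eq R₀ hp₀.symm,
      R.sameGerm_of_h_eq R₁ hp₁.symm⟩
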